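/- Let $\Gamma$ be a finite, connected metric graph: each edge $e$ is an interval $[0,l_e]$ with $0<l_e<\infty$ (loops and parallel edges are allowed). Consider on $\Gamma$ the operator $\psi\mapsto-\psi''$ acting on real functions that are in $H^2([0,l_e])$ on each edge, with Neumann–Kirchhoff conditions at every vertex: $\psi$ is continuous at the vertex, and the outgoing derivatives at the vertex sum to zero. Its spectrum $\sigma(\Gamma)$ is the multiset of its eigenvalues, numbered $\lambda_1\le\lambda_2\le\cdots$ with multiplicity, with corresponding eigenfunctions $\psi_1,\psi_2,\dots$. An eigenfunction is *generic* if its eigenvalue is simple and it vanishes at no vertex. For a generic eigenfunction $\psi$, the *flip count* $\mu_\Gamma(\psi)$ is the number of zeros of $\psi$ on the edges, and the *nodal count* $\nu_\Gamma(\psi)$ is the number of connected components of $\Gamma\setminus\{\psi=0\}$. An *$l$-leaf-pair* consists of two edges of length $l$ that join a common root vertex $u$ to two vertices $v_+,v_-$ of degree one. Let $\Gamma_1$ and $\Gamma_2$ be two such graphs, each containing an $l$-leaf-pair (with the same $l>0$), and suppose that $\sigma(\Gamma_1)=\sigma(\Gamma_2)$ (with multiplicities). Denote the $n$-th eigenfunctions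 of $\Gamma_1$ and $\Gamma_2$ by $\psi_n$ and $\phi_n$, and suppose that $\mu_{\Gamma_1}(\psi_n)=\mu_{\Gamma_2}(\phi_n)$ and $\nu_{\Gamma_1}(\psi_n)=\nu_{\Gamma_2}(\phi_n)$ for every $n$ such that $\psi_n$ and $\phi_n$ are generic. Fix $0<d<l$. For $i=1,2$ let $\bar\Gamma_i$ be the graph obtained from $\Gamma_i$ by gluing the two leaves of its pair together at the points $w_+,w_-$ that lie on the two leaves at distance $d$ from the root; thus $w_\pm$ become one new vertex $w$ of degree four. Denote the $n$-th eigenfunctions of $\bar\Gamma_1$ and $\bar\Gamma_2$ by $\bar\psi_n$ and $\bar\phi_n$. Then 1. $\sigma(\bar\Gamma_1)=\sigma(\bar\Gamma_2)$ (with multiplicities); 2. $\mu_{\bar\Gamma_1}(\bar\psi_n)=\mu_{\bar\Gamma_2}(\bar\phi_n)$ for every $n$ such that $\bar\psi_n$ and $\bar\phi_n$ are generic; 3. $\nu_{\bar\Gamma_1}(\bar\psi_n)=\nu_{\bar\Gamma_2}(\bar\phi_n)$ for every $n$ such that $\bar\psi_n$ and $\bar\phi_n$ are generic. -/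

import Mathlib

/-- A metric multigraph with vertex set `V` and edge set `E`: every edge `e` is an interval
`[0, len e]` of positive length, running from the vertex `src e` to the vertex `tgt e`.
Loops and parallel edges are allowed. -/
structure MetricGraph (V : Type*) (E : Type*) where
  src : E → V
  tgt : E → V
  len : E → ℝ
  len_pos : ∀ e, 0 < len e

/-- `f` belongs to the Sobolev space `H²([0, l])`, with weak derivatives `f' = g` and `f'' = h`
(`f` and `g` being the continuous representatives): `f, g, h` are square integrable, `f` is a
primitive of `g`, and `g` is a primitive of `h`. -/
structure IsH2 (l : ℝ) (f g h : ℝ → ℝ) : Prop where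
  memLp_zero : MeasureTheory.MemLp f 2 (MeasureTheory.volume.restrict (Set.Icc 0 l))
  memLp_one : MeasureTheory.MemLp g 2 (MeasureTheory.volume.restrict (Set.Icc 0 l))
  memLp_two : MeasureTheory.MemLp h 2 (MeasureTheory.volume.restrict (Set.Icc 0 l))
  eq_one : ∀ x ∈ Set.Icc 0 l, f x = f 0 + ∫ t in (0 : ℝ)..x, g t
  eq_two : ∀ x ∈ Set.Icc 0 l, g x = g 0 + ∫ t in (0 : ℝ)..x, h t

theorem IsH2.intervalIntegrable {l : ℝ} {g : ℝ → ℝ}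
    (hg : MeasureTheory.MemLp g 2 (MeasureTheory.volume.restrict (Set.Icc 0 l)))
    {x : ℝ} (hx : x ∈ Set.Icc 0 l) :
    IntervalIntegrable g MeasureTheory.volume 0 x := by
  have h1 : MeasureTheory.IntegrableOn g (Set.Icc 0 l) := hg.integrable (by norm_num)
  rw [intervalIntegrable_iff_integrableOn_Ioc_of_le hx.1]
  exact h1.mono_set fun t ht => ⟨ht.1.le, ht.2.trans hx.2⟩

theorem IsH2.zero (l : ℝ) : IsH2 l 0 0 0 := by
  constructor <;> simp

theorem IsH2.add {l : ℝ} {f g h f' g' h' : ℝ → ℝ} (H : IsH2 l f g h) (H' : IsH2 l f' g' h') :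
    IsH2 l (f + f') (g + g') (h + h') where
  memLp_zero := H.memLp_zero.add H'.memLp_zero
  memLp_one := H.memLp_one.add H'.memLp_one
  memLp_two := H.memLp_two.add H'.memLp_two
  eq_one x hx := by
    simp only [Pi.add_apply]
    rw [intervalIntegral.integral_add (IsH2.intervalIntegrable H.memLp_one hx)
      (IsH2.intervalIntegrable H'.memLp_one hx), H.eq_one x hx, H'.eq_one x hx]
    ring
  eq_two x hx := by
    simp only [Pi.add_apply]
    rw [intervalIntegral.integral_add (IsH2.intervalIntegrable H.memLp_two hx)
      (IsH2.intervalIntegrable H'.memLp_two hx), H.eq_two x hx, H'.eq_two x hx]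
    ring

theorem IsH2.smul {l : ℝ} {f g h : ℝ → ℝ} (c : ℝ) (H : IsH2 l f g h) :
    IsH2 l (c • f) (c • g) (c • h) where
  memLp_zero := H.memLp_zero.const_smul c
  memLp_one := H.memLp_one.const_smul c
  memLp_two := H.memLp_two.const_smul c
  eq_one x hx := by
    simp only [Pi.smul_apply, smul_eq_mul, intervalIntegral.integral_const_mul]
    rw [H.eq_one x hx]
    ring
  eq_two x hx := by
    simp only [Pi.smul_apply, smul_eq_mul, intervalIntegral.integral_const_mul]
    rw [H.eq_two x hx]
    ring

namespace MetricGraph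

/-- The disjoint union of the edges, each edge `e` being the closed interval `[0, len e]`. -/
abbrev EdgePoint {V E : Type*} (Γ : MetricGraph V E) : Type _ :=
  Σ e : E, Set.Icc (0 : ℝ) (Γ.len e)

/-- The point `x` of an edge is an end of that edge, and this end is attached to `v`. -/
def AtVertex {V E : Type*} (Γ : MetricGraph V E) (x : Γ.EdgePoint) (v : V) : Prop :=
  ((x.2 : ℝ) = 0 ∧ Γ.src x.1 = v) ∨ ((x.2 : ℝ) = Γ.len x.1 ∧ Γ.tgt x.1 = v)

/-- The topological space underlying a metric graph: the disjoint union of its edges, with all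
edge ends attached to the same vertex identified, in the quotient topology. -/
def Space {V E : Type*} (Γ : MetricGraph V E) : Type _ :=
  Quot fun x y : Γ.EdgePoint => ∃ v, Γ.AtVertex x v ∧ Γ.AtVertex y v

instance {V E : Type*} (Γ : MetricGraph V E) : TopologicalSpace Γ.Space :=
  inferInstanceAs (TopologicalSpace (Quot _))

/-- The point at position `t` on the edge `e`. -/
def point {V E : Type*} (Γ : MetricGraph V E) (e : E) (t : Set.Icc (0 : ℝ) (Γ.len e)) : Γ.Space :=
  Quot.mk _ ⟨e, t⟩

/-- The restriction of a function on the graph to the edge `e = [0, len e]` (extended to `ℝ` by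
constants; only its values on `[0, len e]` matter). A function on `Γ.Space` is the same as a family
of functions on the edges that agree at the vertices, so the continuity condition at the vertices
is built in. -/
noncomputable def onEdge {V E : Type*} (Γ : MetricGraph V E) (ψ : Γ.Space → ℝ) (e : E) : ℝ → ℝ :=
  Set.IccExtend (Γ.len_pos e).le fun t => ψ (Γ.point e t)

open Classical in
/-- The sum at the vertex `v` of the outgoing derivatives, where `g e` is the derivative along the
edge `e`. A loop contributes both of its ends. -/
noncomputable def outgoingSum {V E : Type*} [Fintype E] (Γ : MetricGraph V E) (g : E → ℝ → ℝ)
    (v : V) : ℝ :=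
  (∑ e, if Γ.src e = v then g e 0 else 0) + ∑ e, if Γ.tgt e = v then -g e (Γ.len e) else 0

/-- The eigenspace, for the real number `r`, of the negative second derivative on `Γ` with
Neumann (Kirchhoff) vertex conditions. -/
noncomputable def eigenspace {V E : Type*} [Fintype E] (Γ : MetricGraph V E) (r : ℝ) :
    Submodule ℝ (Γ.Space → ℝ) where
  carrier := {ψ | ∃ g h : E → ℝ → ℝ,
    (∀ e, IsH2 (Γ.len e) (Γ.onEdge ψ e) (g e) (h e)) ∧
    (∀ e, ∀ᵐ x ∂MeasureTheory.volume.restrict (Set.Icc 0 (Γ.len e)),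
      -h e x = r * Γ.onEdge ψ e x) ∧
    ∀ v, Γ.outgoingSum g v = 0}
  zero_mem' := ⟨0, 0, fun e => IsH2.zero _, fun e => by simp [onEdge, Set.IccExtend], by
    simp [outgoingSum]⟩
  add_mem' := by
    rintro ψ φ ⟨g, h, H, L, K⟩ ⟨g', h', H', L', K'⟩
    refine ⟨g + g', h + h', fun e => (H e).add (H' e), fun e => ?_, fun v => ?_⟩
    · filter_upwards [L e, L' e] with x hx hx'
      have : Γ.onEdge (ψ + φ) e x = Γ.onEdge ψ e x + Γ.onEdge φ e x := rfl
      rw [this, mul_add, ← hx, ← hx']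
      simp only [Pi.add_apply]
      ring
    · have : Γ.outgoingSum (g + g') v = Γ.outgoingSum g v + Γ.outgoingSum g' v := by
        simp only [outgoingSum]
        have h1 : ∀ (p : Prop) [Decidable p] (a b : ℝ),
            (if p then a + b else 0) = (if p then a else 0) + if p then b else 0 := by
          intro p _ a b
          split_ifs <;> simp
        simp only [Pi.add_apply, neg_add, h1, Finset.sum_add_distrib]
        ring
      rw [this, K, K', add_zero]
  smul_mem' := by
    rintro c ψ ⟨g, h, H, L, K⟩
    refine ⟨c • g, c • h, fun e => (H e).smul c, fun e => ?_, fun v => ?_⟩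
    · filter_upwards [L e] with x hx
      have : Γ.onEdge (c • ψ) e x = c * Γ.onEdge ψ e x := rfl
      rw [this, mul_left_comm, ← hx]
      simp only [Pi.smul_apply, smul_eq_mul]
      ring
    · have : Γ.outgoingSum (c • g) v = c * Γ.outgoingSum g v := by
        simp only [outgoingSum]
        rw [mul_add, Finset.mul_sum, Finset.mul_sum]
        refine congrArg₂ (fun a b : ℝ => a + b) (Finset.sum_congr rfl fun e _ => ?_)
          (Finset.sum_congr rfl fun e _ => ?_) <;> split_ifs <;> simp
      rw [this, K, mul_zero]

/-- The spectrum of `Γ` as a multiset of real numbers: `Γ.spec r` is the multiplicity of `r` as an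
eigenvalue (zero if `r` is no eigenvalue). -/
noncomputable def spec {V E : Type*} [Fintype E] (Γ : MetricGraph V E) (r : ℝ) : ℕ :=
  Module.finrank ℝ (Γ.eigenspace r)

/-- `ψ` is an eigenfunction of `Γ` with eigenvalue `r`. -/
def IsEigenfunction {V E : Type*} [Fintype E] (Γ : MetricGraph V E) (r : ℝ) (ψ : Γ.Space → ℝ) :
    Prop :=
  ψ ∈ Γ.eigenspace r ∧ ψ ≠ 0

/-- `r` is the `n`-th eigenvalue of `Γ` in the numbering `r₁ ≤ r₂ ≤ …` by `n = 1, 2, …` in which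
each eigenvalue is repeated according to its multiplicity: fewer than `n` eigenvalues are below
`r`, and at least `n` are at most `r`. -/
def IsNthEigenvalue {V E : Type*} [Fintype E] (Γ : MetricGraph V E) (n : ℕ) (r : ℝ) : Prop :=
  {p : ℝ × ℕ | p.1 < r ∧ p.2 < Γ.spec p.1}.encard < n ∧
    (n : ℕ∞) ≤ {p : ℝ × ℕ | p.1 ≤ r ∧ p.2 < Γ.spec p.1}.encard

/-- `ψ` can serve as the `n`-th eigenfunction of `Γ`. -/
def IsNthEigenfunction {V E : Type*} [Fintype E] (Γ : MetricGraph V E) (n : ℕ)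
    (ψ : Γ.Space → ℝ) : Prop :=
  ∃ r, Γ.IsNthEigenvalue n r ∧ Γ.IsEigenfunction r ψ

/-- `ψ` is a generic eigenfunction: its eigenvalue is simple, and it vanishes at no vertex. -/
def IsGeneric {V E : Type*} [Fintype E] (Γ : MetricGraph V E) (ψ : Γ.Space → ℝ) : Prop :=
  (∃ r, Γ.IsEigenfunction r ψ ∧ Γ.spec r = 1) ∧
    ∀ (x : Γ.EdgePoint) (v : V), Γ.AtVertex x v → ψ (Γ.point x.1 x.2) ≠ 0

/-- The flip count: the number of zeros on the edges. -/
noncomputable def flipCount {V E : Type*} [Fintype E] (Γ : MetricGraph V E) (ψ : Γ.Space → ℝ) :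
    ℕ∞ :=
  ∑ e, {t : Set.Icc (0 : ℝ) (Γ.len e) | ψ (Γ.point e t) = 0}.encard

/-- The nodal count: the number of connected components of the complement of the zero set. -/
noncomputable def nodalCount {V E : Type*} (Γ : MetricGraph V E) (ψ : Γ.Space → ℝ) : ℕ∞ :=
  ENat.card (ConnectedComponents {x : Γ.Space // ψ x ≠ 0})

/-- The degree of a vertex (a loop counts twice). -/
noncomputable def degree {V E : Type*} (Γ : MetricGraph V E) (v : V) : ℕ∞ :=
  {e | Γ.src e = v}.encard + {e | Γ.tgt e = v}.encard

/-- An `l`-leaf-pair: two edges of length `l`, indexed by `Bool`, that join the same vertex `root`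
to vertices `tip i` of degree one. -/
structure LeafPair {V E : Type*} (Γ : MetricGraph V E) (l : ℝ) where
  root : V
  tip : Bool → V
  edge : Bool → E
  edge_injective : Function.Injective edge
  joins : ∀ i, (Γ.src (edge i) = root ∧ Γ.tgt (edge i) = tip i) ∨
    (Γ.src (edge i) = tip i ∧ Γ.tgt (edge i) = root)
  degree_tip : ∀ i, Γ.degree (tip i) = 1
  len_edge : ∀ i, Γ.len (edge i) = l

open Classical in
/-- The position, on its (arbitrarily oriented) edge, of the point of leaf `i` at distance `d`
from the root. -/
noncomputable def LeafPair.pos {V E : Type*} {Γ : MetricGraph V E} {l : ℝ} (P : Γ.LeafPair l)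
    (d : ℝ) (i : Bool) : ℝ :=
  if Γ.src (P.edge i) = P.root then d else l - d

theorem LeafPair.pos_mem {V E : Type*} {Γ : MetricGraph V E} {l : ℝ} (P : Γ.LeafPair l)
    {d : ℝ} (hd : d ∈ Set.Ioo 0 l) (i : Bool) : 0 < P.pos d i ∧ P.pos d i < l := by
  obtain ⟨h0, h1⟩ := hd
  unfold LeafPair.pos
  split_ifs <;> constructor <;> linarith

open Classical in
/-- The graph obtained from `Γ` by gluing the two leaves of the pair `P` together at their points
`w₊`, `w₋` at distance `d` from the root. The new vertex `w` is `none`. The edge `P.edge i` is cut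
at `w` into two: `Sum.inl (P.edge i)` is its first part, which ends at `w`, and `Sum.inr i` is its
second part, which starts at `w`. -/
noncomputable def LeafPair.glue {V E : Type*} {Γ : MetricGraph V E} {l : ℝ} (P : Γ.LeafPair l)
    {d : ℝ} (hd : d ∈ Set.Ioo 0 l) : MetricGraph (Option V) (E ⊕ Bool) where
  src
    | .inl e => some (Γ.src e)
    | .inr _ => none
  tgt
    | .inl e => if e ∈ Set.range P.edge then none else some (Γ.tgt e)
    | .inr i => some (Γ.tgt (P.edge i))
  len
    | .inl e => if e = P.edge true then P.pos d true
        else if e = P.edge false then P.pos d false else Γ.len e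
    | .inr i => l - P.pos d i
  len_pos
    | .inl e => by
        dsimp only
        split_ifs
        · exact (P.pos_mem hd true).1
        · exact (P.pos_mem hd false).1
        · exact Γ.len_pos e
    | .inr i => sub_pos.2 (P.pos_mem hd i).2

end MetricGraph

/-!
# Gluing leaf pairs preserves isospectrality and nodal data

Let `W` be the eigenspace, for the real number `r`, of a graph with a leaf pair, both of whose leaves
have length `l`. Exchanging the two leaves splits `W` into symmetric and antisymmetric functions. An
antisymmetric eigenfunction lives on the leaves, where it solves `-f'' = r f` with a Dirichlet
condition at the root and a Neumann condition at the tip, so whether it exists depends only on `r`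
and `l`. In the glued graph the two inner edges, of length `d`, and the two outer edges, of length
`l - d`, can be exchanged independently; the functions that are antisymmetric under one of these
exchanges are Dirichlet modes of an interval of length `d` or Dirichlet–Neumann modes of an interval
of length `l - d`. The functions that are symmetric under both are the symmetric functions in `W`:
they take equal values at the two glued points, and the vertex condition at the new vertex just says
that the derivative is continuous there. So the two multiplicities differ by a number that depends
only on `r`, `l` and `d` (`MetricGraph.LeafPair.exists_spec_eq`), and the glued graphs are
isospectral if the original ones are.

A generic eigenfunction of the glued graph is symmetric under both exchanges, because an
antisymmetric one vanishes at the root. It therefore comes from a symmetric eigenfunction of the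
original graph, which is again generic: its eigenvalue is simple since a Neumann solution on the
leaf that does not vanish at the root excludes Dirichlet–Neumann modes. The zeros of the two
functions are the same, and the gluing merges two nodal domains exactly if the profile on the leaf
has a zero between the root and the glued point. That profile is determined by the eigenvalue up to
a factor, so the two nodal counts differ by a number that depends only on `r`, `l` and `d`
(`MetricGraph.LeafPair.exists_generic`).

It remains to see that the eigenfunctions obtained on the two original graphs have a common number.
They have the same eigenvalue, and only finitely many eigenvalues of the original graph lie below
it, since gluing removes only Dirichlet–Neumann modes, which are discrete
(`finite_hasDirichletNeumannMode`).

The computations are made for a normal form of the two graphs (`MetricGraph.LeafSite`), in which all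
leaves start at the root; `MetricGraph.Reparam` transports them to arbitrary orientations.
-/

/-! ### Solutions of `-f'' = r f` on subsets of the line -/

/-- On the set `s`, the function `f` solves `-f'' = r f`, and `g` is its derivative. -/
def SolOn (r : ℝ) (s : Set ℝ) (f g : ℝ → ℝ) : Prop :=
  ∀ x ∈ s, HasDerivWithinAt f (g x) s x ∧ HasDerivWithinAt g (-(r * f x)) s x

namespace SolOn

variable {r a b c : ℝ} {s t : Set ℝ} {f g f' g' : ℝ → ℝ}

theorem mono (H : SolOn r s f g) (h : t ⊆ s) : SolOn r t f g :=
  fun x hx => ⟨(H x (h hx)).1.mono h, (H x (h hx)).2.mono h⟩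

theorem congr (H : SolOn r s f g) (hf : Set.EqOn f' f s) (hg : Set.EqOn g' g s) :
    SolOn r s f' g' := fun x hx => by
  rw [hf hx, hg hx]
  exact ⟨(H x hx).1.congr hf (hf hx), (H x hx).2.congr hg (hg hx)⟩

theorem zero (r : ℝ) (s : Set ℝ) : SolOn r s (fun _ => 0) (fun _ => 0) := fun x _ => by
  simpa using hasDerivWithinAt_const x s (0 : ℝ)

theorem add (H : SolOn r s f g) (H' : SolOn r s f' g') :
    SolOn r s (fun x => f x + f' x) (fun x => g x + g' x) := fun x hx =>
  ⟨(H x hx).1.add (H' x hx).1,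
    ((H x hx).2.add (H' x hx).2).congr_deriv (by ring)⟩

theorem smul (H : SolOn r s f g) (k : ℝ) :
    SolOn r s (fun x => k * f x) (fun x => k * g x) := fun x hx =>
  ⟨(H x hx).1.const_mul k, ((H x hx).2.const_mul k).congr_deriv (by ring)⟩

theorem neg (H : SolOn r s f g) : SolOn r s (fun x => -f x) (fun x => -g x) := by
  simpa using H.smul (-1)

theorem sub (H : SolOn r s f g) (H' : SolOn r s f' g') :
    SolOn r s (fun x => f x - f' x) (fun x => g x - g' x) := by
  simpa [sub_eq_add_neg] using H.add H'.neg

theorem continuousOn (H : SolOn r s f g) : ContinuousOn f s :=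
  fun x hx => (H x hx).1.continuousWithinAt

theorem continuousOn_deriv (H : SolOn r s f g) : ContinuousOn g s :=
  fun x hx => (H x hx).2.continuousWithinAt

theorem comp_const_add (H : SolOn r s f g) (k : ℝ) (h : ∀ x ∈ t, k + x ∈ s) :
    SolOn r t (fun x => f (k + x)) (fun x => g (k + x)) := fun x hx => by
  have hd : HasDerivWithinAt (fun x => k + x) 1 t x := (hasDerivWithinAt_id x t).const_add k
  exact ⟨by simpa [Function.comp_def] using (H _ (h x hx)).1.comp x hd h,
    by simpa [Function.comp_def] using (H _ (h x hx)).2.comp x hd h⟩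

theorem comp_const_sub (H : SolOn r s f g) (k : ℝ) (h : ∀ x ∈ t, k - x ∈ s) :
    SolOn r t (fun x => f (k - x)) (fun x => -g (k - x)) := fun x hx => by
  have hd : HasDerivWithinAt (fun x => k - x) (-1) t x := (hasDerivWithinAt_id x t).const_sub k
  refine ⟨by simpa [Function.comp_def] using (H _ (h x hx)).1.comp x hd h, ?_⟩
  exact ((H _ (h x hx)).2.comp x hd h).neg.congr_deriv (by ring)

/-- Solutions on adjacent intervals that agree, with their derivatives, at the common end form a
solution on the union. -/
theorem union (hab : a ≤ b) (hbc : b ≤ c) (H : SolOn r (Set.Icc a b) f g)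
    (H' : SolOn r (Set.Icc b c) f g) : SolOn r (Set.Icc a c) f g := fun x hx => by
  rw [← Set.Icc_union_Icc_eq_Icc hab hbc]
  -- Away from its closure, a set carries no condition on the derivative within it.
  have key : ∀ {v : Set ℝ} {φ : ℝ → ℝ} {m : ℝ}, IsClosed v → x ∉ v →
      HasDerivWithinAt φ m v x := fun hv hxv =>
    HasFDerivWithinAt.of_notMem_closure (by rwa [hv.closure_eq])
  by_cases h1 : x ∈ Set.Icc a b <;> by_cases h2 : x ∈ Set.Icc b c
  · exact ⟨(H x h1).1.union (H' x h2).1, (H x h1).2.union (H' x h2).2⟩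
  · exact ⟨(H x h1).1.union (key isClosed_Icc h2),
      (H x h1).2.union (key isClosed_Icc h2)⟩
  · exact ⟨(key isClosed_Icc h1).union (H' x h2).1,
      (key isClosed_Icc h1).union (H' x h2).2⟩
  · rw [← Set.Icc_union_Icc_eq_Icc hab hbc] at hx
    exact (hx.elim h1 h2).elim

/-- A solution whose value and derivative both vanish at one point is zero. -/
theorem eq_zero (H : SolOn r (Set.Icc a b) f g) (hc : c ∈ Set.Icc a b) (hf : f c = 0)
    (hg : g c = 0) {x : ℝ} (hx : x ∈ Set.Icc a b) : f x = 0 ∧ g x = 0 := by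
  -- The pair `(f, g)` solves the linear first order system `(y, z)' = (z, -r y)`.
  let A : ℝ × ℝ →L[ℝ] ℝ × ℝ :=
    (ContinuousLinearMap.snd ℝ ℝ ℝ).prod (-(r • ContinuousLinearMap.fst ℝ ℝ ℝ))
  let v : ℝ → ℝ × ℝ → ℝ × ℝ := fun _ p => A p
  have hv : ∀ t, LipschitzOnWith ‖A‖₊ (v t) Set.univ := fun t => A.lipschitz.lipschitzOnWith
  let F : ℝ → ℝ × ℝ := fun y => (f y, g y)
  have hF : ∀ y ∈ Set.Icc a b, HasDerivWithinAt F (v y (F y)) (Set.Icc a b) y := fun y hy => by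
    simpa [v, A, F] using (H y hy).1.prodMk (H y hy).2
  have hFc : ContinuousOn F (Set.Icc a b) := fun y hy => (hF y hy).continuousWithinAt
  have h0 : ∀ (y : ℝ) (u : Set ℝ), HasDerivWithinAt (fun _ => (0 : ℝ × ℝ)) (v y 0) u y := by
    intro y u
    simpa [v] using hasDerivWithinAt_const y u (0 : ℝ × ℝ)
  have hFz : F c = 0 := by simp [F, hf, hg]
  suffices F x = 0 by simpa [F, Prod.ext_iff] using this
  rcases le_total c x with h | h
  · refine ODE_solution_unique_of_mem_Icc_right (a := c) (b := b) (s := fun _ => Set.univ)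
      (g := fun _ => 0) (fun t _ => hv t) (hFc.mono (Set.Icc_subset_Icc_left hc.1)) ?_
      (fun _ _ => trivial) continuousOn_const (fun y _ => h0 y _) (fun _ _ => trivial) hFz ⟨h, hx.2⟩
    intro y hy
    exact (hF y ⟨hc.1.trans hy.1, hy.2.le⟩).mono_of_mem_nhdsWithin
      (mem_nhdsWithin.2 ⟨Set.Iio b, isOpen_Iio, hy.2, fun z hz =>
        ⟨(hc.1.trans hy.1).trans hz.2, hz.1.le⟩⟩)
  · refine ODE_solution_unique_of_mem_Icc_left (a := a) (b := c) (s := fun _ => Set.univ)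
      (g := fun _ => 0) (fun t _ => hv t) (hFc.mono (Set.Icc_subset_Icc_right hc.2)) ?_
      (fun _ _ => trivial) continuousOn_const (fun y _ => h0 y _) (fun _ _ => trivial) hFz ⟨hx.1, h⟩
    intro y hy
    exact (hF y ⟨hy.1.le, hy.2.trans hc.2⟩).mono_of_mem_nhdsWithin
      (mem_nhdsWithin.2 ⟨Set.Ioi a, isOpen_Ioi, hy.1, fun z hz =>
        ⟨hz.1.le, (le_trans hz.2 hy.2).trans hc.2⟩⟩)

/-- The derivative is determined by the function. The two solutions may belong to different `r`. -/
theorem deriv_unique {r' : ℝ} (hab : a < b) (H : SolOn r (Set.Icc a b) f g)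
    (H' : SolOn r' (Set.Icc a b) f' g') (h : Set.EqOn f f' (Set.Icc a b)) :
    Set.EqOn g g' (Set.Icc a b) := fun x hx =>
  (uniqueDiffOn_Icc hab x hx).eq_deriv _ (H x hx).1 ((H' x hx).1.congr h (h hx))

theorem derivWithin_eq (hab : a < b) (H : SolOn r (Set.Icc a b) f g) {x : ℝ}
    (hx : x ∈ Set.Icc a b) : derivWithin f (Set.Icc a b) x = g x :=
  (H x hx).1.derivWithin (uniqueDiffOn_Icc hab x hx)

end SolOn

/-- Eigenfunctions are classical solutions: a function of class `H²` whose weak second derivative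
is `-r f` solves the differential equation pointwise. -/
theorem IsH2.solOn {r L : ℝ} {f g h : ℝ → ℝ} (hL : 0 < L) (H : IsH2 L f g h)
    (hh : ∀ᵐ x ∂MeasureTheory.volume.restrict (Set.Icc 0 L), -h x = r * f x) :
    SolOn r (Set.Icc 0 L) f g := by
  have prim : ∀ {φ ψ : ℝ → ℝ}, MeasureTheory.MemLp ψ 2
      (MeasureTheory.volume.restrict (Set.Icc 0 L)) →
      (∀ x ∈ Set.Icc 0 L, φ x = φ 0 + ∫ t in (0 : ℝ)..x, ψ t) →
      ContinuousOn φ (Set.Icc 0 L) := by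
    intro φ ψ hψ he
    have h1 : MeasureTheory.IntegrableOn ψ (Set.uIcc 0 L) := by
      rw [Set.uIcc_of_le hL.le]
      exact hψ.integrable (by norm_num)
    have h2 := intervalIntegral.continuousOn_primitive_interval h1
    rw [Set.uIcc_of_le hL.le] at h2
    exact (continuousOn_const.add h2).congr he
  have deriv : ∀ {φ ψ : ℝ → ℝ}, ContinuousOn ψ (Set.Icc 0 L) →
      (∀ x ∈ Set.Icc 0 L, φ x = φ 0 + ∫ t in (0 : ℝ)..x, ψ t) →
      ∀ x ∈ Set.Icc 0 L, HasDerivWithinAt φ (ψ x) (Set.Icc 0 L) x := by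
    intro φ ψ hψ he x hx
    -- The fundamental theorem of calculus is applied to the continuous extension of `ψ` to `ℝ`.
    have hc : Continuous (Set.IccExtend hL.le ((Set.Icc 0 L).domRestrict ψ)) :=
      (continuousOn_iff_continuous_domRestrict.1 hψ).Icc_extend'
    have hE : ∀ y ∈ Set.Icc 0 L, Set.IccExtend hL.le ((Set.Icc 0 L).domRestrict ψ) y = ψ y :=
      fun y hy => by rw [Set.IccExtend_of_mem _ _ hy]; rfl
    have h1 := ((hc.integral_hasStrictDerivAt 0 x).hasDerivAt.const_add (φ 0)).hasDerivWithinAt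
      (s := Set.Icc 0 L)
    rw [hE x hx] at h1
    have h2 : ∀ y ∈ Set.Icc 0 L, φ y = φ 0 + ∫ t in (0 : ℝ)..y,
        Set.IccExtend hL.le ((Set.Icc 0 L).domRestrict ψ) t := by
      intro y hy
      rw [he y hy]
      congr 1
      refine intervalIntegral.integral_congr fun z hz => ?_
      rw [Set.uIcc_of_le hy.1] at hz
      exact (hE z ⟨hz.1, hz.2.trans hy.2⟩).symm
    exact h1.congr h2 (h2 x hx)
  have hg := prim H.memLp_two H.eq_two
  have hf := prim H.memLp_one H.eq_one
  have e2 : ∀ x ∈ Set.Icc 0 L, g x = g 0 + ∫ t in (0 : ℝ)..x, -(r * f t) := by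
    intro x hx
    rw [H.eq_two x hx]
    congr 1
    refine intervalIntegral.integral_congr_ae_restrict ?_
    rw [Set.uIoc_of_le hx.1]
    refine MeasureTheory.ae_restrict_of_ae_restrict_of_subset
      (t := Set.Icc 0 L) (fun y hy => ⟨hy.1.le, hy.2.trans hx.2⟩) ?_
    filter_upwards [hh] with y hy
    rw [← hy, neg_neg]
  intro x hx
  exact ⟨deriv hg H.eq_one x hx, deriv ((continuousOn_const.mul hf).neg) e2 x hx⟩

theorem SolOn.isH2 {r L : ℝ} {f g : ℝ → ℝ} (H : SolOn r (Set.Icc 0 L) f g) :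
    IsH2 L f g (fun x => -(r * f x)) := by
  have mem : ∀ {φ : ℝ → ℝ}, ContinuousOn φ (Set.Icc 0 L) →
      MeasureTheory.MemLp φ 2 (MeasureTheory.volume.restrict (Set.Icc 0 L)) := by
    intro φ hφ
    obtain ⟨C, hC⟩ := isCompact_Icc.exists_bound_of_continuousOn hφ
    refine MeasureTheory.MemLp.of_bound (hφ.aestronglyMeasurable measurableSet_Icc) C ?_
    filter_upwards [MeasureTheory.ae_restrict_mem measurableSet_Icc] with x hx using hC x hx
  have prim : ∀ {φ ψ : ℝ → ℝ}, ContinuousOn ψ (Set.Icc 0 L) →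
      (∀ x ∈ Set.Icc 0 L, HasDerivWithinAt φ (ψ x) (Set.Icc 0 L) x) →
      ∀ x ∈ Set.Icc 0 L, φ x = φ 0 + ∫ t in (0 : ℝ)..x, ψ t := by
    intro φ ψ hψ hd x hx
    have hsub : Set.Icc 0 x ⊆ Set.Icc 0 L := Set.Icc_subset_Icc_right hx.2
    rw [intervalIntegral.integral_eq_sub_of_hasDeriv_right_of_le_real hx.1
      (fun y hy => ((hd y (hsub hy)).continuousWithinAt).mono hsub)
      (fun y hy => ?_) ((hψ.mono hsub).integrableOn_Icc)]
    · ring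
    · have hy' : y < L := hy.2.trans_le hx.2
      exact (hd y (hsub ⟨hy.1.le, hy.2.le⟩)).mono_of_mem_nhdsWithin
        (mem_nhdsWithin.2 ⟨Set.Iio L, isOpen_Iio, hy', fun z hz =>
          ⟨hy.1.le.trans (le_of_lt hz.2), hz.1.le⟩⟩)
  have hc : ContinuousOn (fun x => -(r * f x)) (Set.Icc 0 L) :=
    (continuousOn_const.mul H.continuousOn).neg
  exact ⟨mem H.continuousOn, mem H.continuousOn_deriv, mem hc,
    prim H.continuousOn_deriv fun x hx => (H x hx).1, prim hc fun x hx => (H x hx).2⟩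

/-- There is a nonzero solution of `-f'' = r f` on `[0, l]` with a Dirichlet condition at `0` and a
Neumann condition at `l`. -/
def HasDirichletNeumannMode (r l : ℝ) : Prop :=
  ∃ f g, SolOn r (Set.Icc 0 l) f g ∧ f 0 = 0 ∧ g l = 0 ∧ f l ≠ 0

/-- There is a nonzero solution of `-f'' = r f` on `[0, l]` with Dirichlet conditions at both
ends. -/
def HasDirichletMode (r l : ℝ) : Prop :=
  ∃ f g, SolOn r (Set.Icc 0 l) f g ∧ f 0 = 0 ∧ f l = 0 ∧ g 0 ≠ 0

/-- Since `(f f')' = f'² - r f²`, for `r ≤ 0` the product `f f'` is monotone. It vanishes at both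
ends, so `f²` is constant, hence zero. -/
theorem HasDirichletNeumannMode.pos {r l : ℝ} (hl : 0 < l) (H : HasDirichletNeumannMode r l) :
    0 < r := by
  obtain ⟨f, g, S, f0, gl, fl⟩ := H
  by_contra! hr
  have h0 : (0 : ℝ) ∈ Set.Icc 0 l := ⟨le_rfl, hl.le⟩
  have h1 : l ∈ Set.Icc 0 l := ⟨hl.le, le_rfl⟩
  have hd : ∀ x ∈ Set.Icc 0 l,
      HasDerivWithinAt (fun x => f x * g x) (g x * g x - r * (f x * f x)) (Set.Icc 0 l) x :=
    fun x hx => ((S x hx).1.mul (S x hx).2).congr_deriv (by ring)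
  have hmono : MonotoneOn (fun x => f x * g x) (Set.Icc 0 l) := by
    refine monotoneOn_of_deriv_nonneg (convex_Icc 0 l)
      (fun x hx => (hd x hx).continuousWithinAt) ?_ ?_ <;> rw [interior_Icc] <;> intro x hx
    · exact ((hd x ⟨hx.1.le, hx.2.le⟩).hasDerivAt
        (Icc_mem_nhds hx.1 hx.2)).differentiableAt.differentiableWithinAt
    · rw [((hd x ⟨hx.1.le, hx.2.le⟩).hasDerivAt (Icc_mem_nhds hx.1 hx.2)).deriv]
      nlinarith [mul_self_nonneg (g x), mul_self_nonneg (f x)]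
  have hz : ∀ x ∈ Set.Icc 0 l, f x * g x = 0 := fun x hx => by
    have a := hmono h0 hx hx.1
    have b := hmono hx h1 hx.2
    simp only [f0, gl, zero_mul, mul_zero] at a b
    exact le_antisymm b a
  have hsq : ∀ x ∈ Set.Icc 0 l, HasDerivWithinAt (fun x => f x * f x) 0 (Set.Icc 0 l) x :=
    fun x hx => ((S x hx).1.mul (S x hx).1).congr_deriv (by linarith [hz x hx])
  have hconst := (convex_Icc 0 l).norm_image_sub_le_of_norm_hasDerivWithin_le (C := 0) hsq
    (by simp) h0 h1
  simp only [f0, zero_mul, sub_zero, norm_le_zero_iff, mul_self_eq_zero] at hconst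
  exact fl hconst

/-- The Dirichlet–Neumann eigenvalues are discrete: they are the squares of the `k > 0` with
`cos (k l) = 0`. -/
theorem finite_hasDirichletNeumannMode {l : ℝ} (hl : 0 < l) (r : ℝ) :
    {q : ℝ | q < r ∧ HasDirichletNeumannMode q l}.Finite := by
  refine ((Set.finite_Icc (0 : ℤ) ⌈√r * l⌉).image
    fun m : ℤ => ((2 * m + 1) * Real.pi / 2 / l) ^ 2).subset ?_
  rintro q ⟨hq, H⟩
  have hq0 := H.pos hl
  obtain ⟨f, g, S, f0, gl, fl⟩ := H
  set k := √q with hk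
  have hk0 : 0 < k := Real.sqrt_pos.2 hq0
  have hkk : k * k = q := Real.mul_self_sqrt hq0.le
  have h0 : (0 : ℝ) ∈ Set.Icc 0 l := ⟨le_rfl, hl.le⟩
  have h1 : l ∈ Set.Icc 0 l := ⟨hl.le, le_rfl⟩
  have T : SolOn q (Set.Icc 0 l) (fun x => g 0 / k * Real.sin (k * x))
      (fun x => g 0 * Real.cos (k * x)) := fun x _ => by
    have hx : HasDerivAt (fun x => k * x) k x := by simpa using (hasDerivAt_id x).const_mul k
    refine ⟨(hx.sin.const_mul (g 0 / k)).hasDerivWithinAt.congr_deriv (by field_simp),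
      (hx.cos.const_mul (g 0)).hasDerivWithinAt.congr_deriv ?_⟩
    rw [← hkk]
    field_simp
  have Z := (S.sub T).eq_zero h0 (by simp [f0]) (by simp) h1
  have hg0 : g 0 ≠ 0 := fun h => fl (by simpa [h] using Z.1)
  have hcos : Real.cos (k * l) = 0 := by
    have := Z.2
    rw [gl, zero_sub, neg_eq_zero, mul_eq_zero] at this
    exact this.resolve_left hg0
  obtain ⟨m, hm⟩ := Real.cos_eq_zero_iff.1 hcos
  -- From `0 < k l ≤ √r l` and `k l = (2 m + 1) π / 2` follow the bounds on `m`.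
  refine ⟨m, ⟨?_, ?_⟩, ?_⟩
  · by_contra! hneg
    have : (m : ℝ) ≤ -1 := by exact_mod_cast (by omega : m ≤ -1)
    nlinarith [Real.pi_pos, mul_pos hk0 hl]
  · have hle : (m : ℝ) ≤ √r * l := by
      have : k * l ≤ √r * l := mul_le_mul_of_nonneg_right (Real.sqrt_le_sqrt hq.le) hl.le
      by_contra! hlt
      have hm0 : 0 < (m : ℝ) := (by positivity : 0 ≤ √r * l).trans_lt hlt
      nlinarith [Real.pi_gt_three]
    exact_mod_cast hle.trans (Int.le_ceil _)
  · simp only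
    rw [← hm, mul_div_cancel_right₀ _ hl.ne', sq, hkk]

namespace MetricGraph

variable {V E : Type*} {Γ : MetricGraph V E}

/-! ### Functions on a metric graph -/

theorem left_mem (Γ : MetricGraph V E) (e : E) : (0 : ℝ) ∈ Set.Icc 0 (Γ.len e) :=
  ⟨le_rfl, (Γ.len_pos e).le⟩

theorem right_mem (Γ : MetricGraph V E) (e : E) : Γ.len e ∈ Set.Icc 0 (Γ.len e) :=
  ⟨(Γ.len_pos e).le, le_rfl⟩

theorem onEdge_of_mem (ψ : Γ.Space → ℝ) (e : E) {t : ℝ} (ht : t ∈ Set.Icc 0 (Γ.len e)) :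
    Γ.onEdge ψ e t = ψ (Γ.point e ⟨t, ht⟩) := Set.IccExtend_of_mem _ _ ht

theorem onEdge_coe (ψ : Γ.Space → ℝ) (e : E) (t : Set.Icc 0 (Γ.len e)) :
    Γ.onEdge ψ e t = ψ (Γ.point e t) := onEdge_of_mem ψ e t.2

theorem exists_point (x : Γ.Space) : ∃ e t, x = Γ.point e t := by
  obtain ⟨⟨e, t⟩, rfl⟩ := Quot.exists_rep x
  exact ⟨e, t, rfl⟩

theorem funext_onEdge {ψ φ : Γ.Space → ℝ}
    (h : ∀ e, ∀ t ∈ Set.Icc 0 (Γ.len e), Γ.onEdge ψ e t = Γ.onEdge φ e t) : ψ = φ := by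
  funext x
  obtain ⟨e, t, rfl⟩ := exists_point x
  simpa only [onEdge_coe] using h e t t.2

theorem AtVertex.unique {x : Γ.EdgePoint} {v w : V} (h : Γ.AtVertex x v) (h' : Γ.AtVertex x w) :
    v = w := by
  have := Γ.len_pos x.1
  rcases h with ⟨h1, h2⟩ | ⟨h1, h2⟩ <;> rcases h' with ⟨h3, h4⟩ | ⟨h3, h4⟩
  · exact h2.symm.trans h4
  · linarith
  · linarith
  · exact h2.symm.trans h4

/-- Two points of the edges are identified in the graph only if they are equal or are ends
attached to the same vertex. -/
theorem mk_eq_mk_iff {x y : Γ.EdgePoint} :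
    (Γ.point x.1 x.2 = Γ.point y.1 y.2) ↔ x = y ∨ ∃ v, Γ.AtVertex x v ∧ Γ.AtVertex y v := by
  constructor
  · intro h
    have h' : Relation.EqvGen (fun x y => ∃ v, Γ.AtVertex x v ∧ Γ.AtVertex y v) x y :=
      Quot.eqvGen_exact h
    clear h
    induction h' with
    | rel x y h => exact Or.inr h
    | refl x => exact Or.inl rfl
    | symm x y _ ih =>
      rcases ih with rfl | ⟨v, h1, h2⟩
      · exact Or.inl rfl
      · exact Or.inr ⟨v, h2, h1⟩
    | trans x y z _ _ ih1 ih2 =>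
      rcases ih1 with rfl | ⟨v, h1, h2⟩
      · exact ih2
      · rcases ih2 with rfl | ⟨w, h3, h4⟩
        · exact Or.inr ⟨v, h1, h2⟩
        · obtain rfl := h2.unique h3
          exact Or.inr ⟨v, h1, h4⟩
  · rintro (rfl | h)
    · rfl
    · exact Quot.sound h

theorem AtVertex.apply_eq {x y : Γ.EdgePoint} {v : V} (h : Γ.AtVertex x v) (h' : Γ.AtVertex y v)
    (ψ : Γ.Space → ℝ) : ψ (Γ.point x.1 x.2) = ψ (Γ.point y.1 y.2) :=
  congrArg ψ (Quot.sound ⟨v, h, h'⟩)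

theorem atVertex_src (e : E) : Γ.AtVertex ⟨e, 0, Γ.left_mem e⟩ (Γ.src e) := Or.inl ⟨rfl, rfl⟩

theorem atVertex_tgt (e : E) : Γ.AtVertex ⟨e, Γ.len e, Γ.right_mem e⟩ (Γ.tgt e) :=
  Or.inr ⟨rfl, rfl⟩

/-- A function on the graph has well-defined values at the vertices. The value at an isolated
vertex, which is no point of the graph, is arbitrary. -/
theorem exists_vertexValue (ψ : Γ.Space → ℝ) : ∃ u : V → ℝ,
    (∀ (x : Γ.EdgePoint) (v : V), Γ.AtVertex x v → ψ (Γ.point x.1 x.2) = u v) ∧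
    (∀ e, Γ.onEdge ψ e 0 = u (Γ.src e)) ∧ ∀ e, Γ.onEdge ψ e (Γ.len e) = u (Γ.tgt e) := by
  classical
  let u : V → ℝ := fun v =>
    if h : ∃ x : Γ.EdgePoint, Γ.AtVertex x v then ψ (Γ.point h.choose.1 h.choose.2) else 0
  have key : ∀ (x : Γ.EdgePoint) (v : V), Γ.AtVertex x v → ψ (Γ.point x.1 x.2) = u v := by
    intro x v h
    have h' : ∃ x : Γ.EdgePoint, Γ.AtVertex x v := ⟨x, h⟩
    simp only [u, dif_pos h']
    exact h.apply_eq h'.choose_spec ψ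
  refine ⟨u, key, fun e => ?_, fun e => ?_⟩
  · rw [onEdge_of_mem ψ e (Γ.left_mem e)]
    exact key _ _ (atVertex_src e)
  · rw [onEdge_of_mem ψ e (Γ.right_mem e)]
    exact key _ _ (atVertex_tgt e)

/-- The function on the graph that is given on each edge `e` by `f e`, where `u` records the common
values at the vertices. -/
def ofEdges (Γ : MetricGraph V E) (f : E → ℝ → ℝ) (u : V → ℝ) (h0 : ∀ e, f e 0 = u (Γ.src e))
    (h1 : ∀ e, f e (Γ.len e) = u (Γ.tgt e)) : Γ.Space → ℝ :=
  Quot.lift (fun x => f x.1 x.2) (by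
    have key : ∀ (x : Γ.EdgePoint) (v : V), Γ.AtVertex x v → f x.1 x.2 = u v := by
      rintro x v (⟨hx, rfl⟩ | ⟨hx, rfl⟩)
      · rw [hx, h0]
      · rw [hx, h1]
    rintro x y ⟨v, hx, hy⟩
    exact (key x v hx).trans (key y v hy).symm)

theorem onEdge_ofEdges {f : E → ℝ → ℝ} {u : V → ℝ} {h0 : ∀ e, f e 0 = u (Γ.src e)}
    {h1 : ∀ e, f e (Γ.len e) = u (Γ.tgt e)} (e : E) {t : ℝ} (ht : t ∈ Set.Icc 0 (Γ.len e)) :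
    Γ.onEdge (Γ.ofEdges f u h0 h1) e t = f e t := onEdge_of_mem _ e ht

/-! ### Eigenfunctions -/

section eigen

variable [Fintype E] {r : ℝ} {ψ : Γ.Space → ℝ}

theorem mem_eigenspace_iff : ψ ∈ Γ.eigenspace r ↔ ∃ g : E → ℝ → ℝ,
    (∀ e, SolOn r (Set.Icc 0 (Γ.len e)) (Γ.onEdge ψ e) (g e)) ∧ ∀ v, Γ.outgoingSum g v = 0 := by
  constructor
  · rintro ⟨g, h, H, K, L⟩
    exact ⟨g, fun e => (H e).solOn (Γ.len_pos e) (K e), L⟩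
  · rintro ⟨g, H, L⟩
    exact ⟨g, fun e x => -(r * Γ.onEdge ψ e x), fun e => (H e).isH2,
      fun e => Filter.Eventually.of_forall fun x => neg_neg _, L⟩

theorem continuous_of_mem_eigenspace (h : ψ ∈ Γ.eigenspace r) : Continuous ψ := by
  obtain ⟨g, H, -⟩ := mem_eigenspace_iff.1 h
  refine (isQuotientMap_quot_mk (r := fun x y : Γ.EdgePoint =>
    ∃ v, Γ.AtVertex x v ∧ Γ.AtVertex y v)).continuous_iff.2 (continuous_sigma fun e => ?_)
  refine (continuousOn_iff_continuous_domRestrict.1 (H e).continuousOn).congr fun t => ?_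
  exact onEdge_coe ψ e t

theorem eigenvalue_unique {r' : ℝ} (h : Γ.IsEigenfunction r ψ) (h' : Γ.IsEigenfunction r' ψ) :
    r = r' := by
  obtain ⟨g, H, -⟩ := mem_eigenspace_iff.1 h.1
  obtain ⟨g', H', -⟩ := mem_eigenspace_iff.1 h'.1
  by_contra hne
  refine h.2 (funext_onEdge fun e t ht => ?_)
  have hg := (H e).deriv_unique (Γ.len_pos e) (H' e) fun _ _ => rfl
  have := (uniqueDiffOn_Icc (Γ.len_pos e) t ht).eq_deriv _ (H e t ht).2
    ((H' e t ht).2.congr hg (hg ht))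
  have h2 : (r - r') * Γ.onEdge ψ e t = 0 := by linarith
  rw [(mul_eq_zero.1 h2).resolve_left (sub_ne_zero.2 hne), onEdge_of_mem _ _ ht]
  rfl

/-- The derivative of an eigenfunction at the start of the edge `e`, as a linear functional. -/
noncomputable def startDeriv (Γ : MetricGraph V E) (r : ℝ) (e : E) : Γ.eigenspace r →ₗ[ℝ] ℝ where
  toFun ψ := derivWithin (Γ.onEdge ψ e) (Set.Icc 0 (Γ.len e)) 0
  map_add' ψ φ := by
    obtain ⟨g, H, -⟩ := mem_eigenspace_iff.1 ψ.2
    obtain ⟨g', H', -⟩ := mem_eigenspace_iff.1 φ.2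
    exact derivWithin_add (H e 0 (Γ.left_mem e)).1.differentiableWithinAt
      (H' e 0 (Γ.left_mem e)).1.differentiableWithinAt
  map_smul' c ψ := by
    obtain ⟨g, H, -⟩ := mem_eigenspace_iff.1 ψ.2
    exact derivWithin_const_mul c (H e 0 (Γ.left_mem e)).1.differentiableWithinAt

theorem startDeriv_eq {e : E} {g : ℝ → ℝ} (h : ψ ∈ Γ.eigenspace r)
    (H : SolOn r (Set.Icc 0 (Γ.len e)) (Γ.onEdge ψ e) g) : Γ.startDeriv r e ⟨ψ, h⟩ = g 0 :=
  H.derivWithin_eq (Γ.len_pos e) (Γ.left_mem e)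

instance : FiniteDimensional ℝ (Γ.eigenspace r) := by
  let T : Γ.eigenspace r →ₗ[ℝ] E → ℝ × ℝ := LinearMap.pi fun e =>
    ((LinearMap.proj (Γ.point e ⟨0, Γ.left_mem e⟩)).comp (Γ.eigenspace r).subtype).prod
      (Γ.startDeriv r e)
  refine FiniteDimensional.of_injective T ((injective_iff_map_eq_zero T).2 ?_)
  rintro ⟨ψ, hψ⟩ hT
  obtain ⟨g, H, -⟩ := mem_eigenspace_iff.1 hψ
  refine Subtype.ext (funext_onEdge fun e t ht => ?_)
  have h1 := congrFun hT e
  have h2 : ψ (Γ.point e ⟨0, Γ.left_mem e⟩) = 0 := congrArg Prod.fst h1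
  have h3 : Γ.startDeriv r e ⟨ψ, hψ⟩ = 0 := congrArg Prod.snd h1
  rw [startDeriv_eq hψ (H e)] at h3
  rw [← onEdge_of_mem ψ e (Γ.left_mem e)] at h2
  rw [((H e).eq_zero (Γ.left_mem e) h2 h3 ht).1, onEdge_of_mem _ _ ht]
  rfl

theorem IsGeneric.spec_eq_one (h : Γ.IsGeneric ψ) (h' : Γ.IsEigenfunction r ψ) :
    Γ.spec r = 1 := by
  obtain ⟨⟨r', h1, h2⟩, -⟩ := h
  rwa [eigenvalue_unique h' h1]

end eigen

end MetricGraph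

namespace MetricGraph

variable {V E E' : Type*}

/-! ### Relabelling and reversing edges -/

/-- An isomorphism of metric graphs that fixes the vertices: a bijection of the edges that
preserves lengths and ends, except that the edges `e` with `flip e` are reversed. -/
structure Reparam (Γ : MetricGraph V E) (Γ' : MetricGraph V E') where
  edge : E ≃ E'
  flip : E → Bool
  len_edge : ∀ e, Γ'.len (edge e) = Γ.len e
  src_edge : ∀ e, Γ'.src (edge e) = if flip e then Γ.tgt e else Γ.src e
  tgt_edge : ∀ e, Γ'.tgt (edge e) = if flip e then Γ.src e else Γ.tgt e

theorem EdgePoint.ext {Γ : MetricGraph V E} {x y : Γ.EdgePoint} (h : x.1 = y.1)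
    (h' : (x.2 : ℝ) = y.2) : x = y := by
  obtain ⟨e, t⟩ := x
  obtain ⟨e', t'⟩ := y
  obtain rfl : e = e' := h
  exact congrArg (Sigma.mk e) (Subtype.ext h')

theorem encard_zeros {Γ : MetricGraph V E} (ψ : Γ.Space → ℝ) (e : E) :
    {t : Set.Icc (0 : ℝ) (Γ.len e) | ψ (Γ.point e t) = 0}.encard =
      {x : ℝ | x ∈ Set.Icc 0 (Γ.len e) ∧ Γ.onEdge ψ e x = 0}.encard := by
  rw [← Function.Injective.encard_image Subtype.val_injective]
  congr 1
  ext x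
  constructor
  · rintro ⟨t, ht, rfl⟩
    exact ⟨t.2, (onEdge_coe ψ e t).trans ht⟩
  · rintro ⟨hx, h⟩
    exact ⟨⟨x, hx⟩, (onEdge_of_mem ψ e hx).symm.trans h, rfl⟩

namespace Reparam

variable {Γ : MetricGraph V E} {Γ' : MetricGraph V E'} (R : Reparam Γ Γ')

/-- The inverse isomorphism. -/
def symm : Reparam Γ' Γ where
  edge := R.edge.symm
  flip e := R.flip (R.edge.symm e)
  len_edge e := by simpa using (R.len_edge (R.edge.symm e)).symm
  src_edge e := by
    have h1 := R.src_edge (R.edge.symm e)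
    have h2 := R.tgt_edge (R.edge.symm e)
    rw [R.edge.apply_symm_apply] at h1 h2
    rw [h1, h2]
    split_ifs <;> rfl
  tgt_edge e := by
    have h1 := R.src_edge (R.edge.symm e)
    have h2 := R.tgt_edge (R.edge.symm e)
    rw [R.edge.apply_symm_apply] at h1 h2
    rw [h1, h2]
    split_ifs <;> rfl

/-- The position on `R.edge e` of the point at position `t` on `e`. -/
def coord (e : E) (t : ℝ) : ℝ := if R.flip e then Γ.len e - t else t

theorem coord_mem {e : E} {t : ℝ} (ht : t ∈ Set.Icc 0 (Γ.len e)) :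
    R.coord e t ∈ Set.Icc 0 (Γ'.len (R.edge e)) := by
  rw [R.len_edge, coord]
  obtain ⟨h0, h1⟩ := ht
  split_ifs <;> constructor <;> linarith

theorem coord_coord (e : E) (t : ℝ) : R.coord e (R.coord e t) = t := by
  simp only [coord]
  split_ifs <;> ring

/-- The map on edge points. -/
def pt (x : Γ.EdgePoint) : Γ'.EdgePoint := ⟨R.edge x.1, R.coord x.1 x.2, R.coord_mem x.2.2⟩

theorem atVertex_pt {x : Γ.EdgePoint} {v : V} (h : Γ.AtVertex x v) : Γ'.AtVertex (R.pt x) v := by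
  have h1 := R.src_edge x.1
  have h2 := R.tgt_edge x.1
  have h3 := R.len_edge x.1
  by_cases hf : R.flip x.1 <;> simp only [hf, if_true] at h1 h2
  · rcases h with ⟨h, h'⟩ | ⟨h, h'⟩
    · exact Or.inr ⟨by simp [pt, coord, hf, h, h3], h2.trans h'⟩
    · exact Or.inl ⟨by simp [pt, coord, hf, h], h1.trans h'⟩
  · rcases h with ⟨h, h'⟩ | ⟨h, h'⟩
    · exact Or.inl ⟨by simp [pt, coord, hf, h], h1.trans h'⟩
    · exact Or.inr ⟨by simp [pt, coord, hf, h, h3], h2.trans h'⟩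

/-- The map on points of the graphs. -/
def map : Γ.Space → Γ'.Space :=
  Quot.map R.pt fun _ _ ⟨v, h, h'⟩ => ⟨v, R.atVertex_pt h, R.atVertex_pt h'⟩

theorem symm_pt_pt (x : Γ.EdgePoint) : R.symm.pt (R.pt x) = x := by
  have h := R.len_edge x.1
  refine EdgePoint.ext (R.edge.symm_apply_apply _) ?_
  simp only [pt, coord, symm, Equiv.symm_apply_apply, h]
  split_ifs <;> ring

theorem pt_symm_pt (x : Γ'.EdgePoint) : R.pt (R.symm.pt x) = x := by
  have h := R.len_edge (R.edge.symm x.1)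
  rw [Equiv.apply_symm_apply] at h
  refine EdgePoint.ext (R.edge.apply_symm_apply _) ?_
  simp only [pt, coord, symm, h]
  split_ifs <;> ring

theorem continuous_map : Continuous R.map := by
  refine (isQuotientMap_quot_mk (r := fun x y : Γ.EdgePoint =>
    ∃ v, Γ.AtVertex x v ∧ Γ.AtVertex y v)).continuous_iff.2 (continuous_sigma fun e => ?_)
  have h : Continuous fun t : Set.Icc (0 : ℝ) (Γ.len e) =>
      (⟨R.coord e t, R.coord_mem t.2⟩ : Set.Icc (0 : ℝ) (Γ'.len (R.edge e))) := by
    refine Continuous.subtype_mk ?_ _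
    simp only [coord]
    split_ifs <;> fun_prop
  exact continuous_quot_mk.comp
    ((continuous_sigmaMk (σ := fun e' => Set.Icc (0 : ℝ) (Γ'.len e'))).comp h)

/-- The homeomorphism of the underlying spaces. -/
def homeo : Γ.Space ≃ₜ Γ'.Space where
  toFun := R.map
  invFun := R.symm.map
  left_inv := by
    rintro ⟨x⟩
    exact congrArg (Quot.mk _) (R.symm_pt_pt x)
  right_inv := by
    rintro ⟨x⟩
    exact congrArg (Quot.mk _) (R.pt_symm_pt x)
  continuous_toFun := R.continuous_map
  continuous_invFun := R.symm.continuous_map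

theorem onEdge_comp (ψ : Γ'.Space → ℝ) {e : E} {t : ℝ} (ht : t ∈ Set.Icc 0 (Γ.len e)) :
    Γ.onEdge (ψ ∘ R.homeo) e t = Γ'.onEdge ψ (R.edge e) (R.coord e t) := by
  rw [onEdge_of_mem _ e ht, onEdge_of_mem _ _ (R.coord_mem ht)]
  rfl

theorem ne_zero {ψ : Γ'.Space → ℝ} (h : ψ ≠ 0) : ψ ∘ R.homeo ≠ 0 := fun h0 =>
  h (funext fun x => by
    obtain ⟨y, rfl⟩ := R.homeo.surjective x
    exact congrFun h0 y)

theorem nodalCount_comp (ψ : Γ'.Space → ℝ) : Γ.nodalCount (ψ ∘ R.homeo) = Γ'.nodalCount ψ := by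
  let h : {x : Γ.Space // (ψ ∘ R.homeo) x ≠ 0} ≃ₜ {x : Γ'.Space // ψ x ≠ 0} :=
    R.homeo.subtype fun _ => Iff.rfl
  refine ENat.card_congr
    ⟨h.continuous.connectedComponentsMap, h.symm.continuous.connectedComponentsMap, ?_, ?_⟩
  · intro c
    obtain ⟨x, rfl⟩ := ConnectedComponents.surjective_coe c
    exact congrArg ConnectedComponents.mk (h.symm_apply_apply x)
  · intro c
    obtain ⟨x, rfl⟩ := ConnectedComponents.surjective_coe c
    exact congrArg ConnectedComponents.mk (h.apply_symm_apply x)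

variable [Fintype E] [Fintype E']

theorem comp_mem_eigenspace {r : ℝ} {ψ : Γ'.Space → ℝ} (h : ψ ∈ Γ'.eigenspace r) :
    ψ ∘ R.homeo ∈ Γ.eigenspace r := by
  classical
  obtain ⟨g, H, K⟩ := mem_eigenspace_iff.1 h
  refine mem_eigenspace_iff.2 ⟨fun e t => if R.flip e then -g (R.edge e) (Γ.len e - t)
    else g (R.edge e) t, fun e => ?_, fun v => ?_⟩
  · have He := H (R.edge e)
    rw [R.len_edge] at He
    by_cases hf : R.flip e
    · refine (He.comp_const_sub (t := Set.Icc 0 (Γ.len e)) (Γ.len e) fun x hx =>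
        ⟨by linarith [hx.2], by linarith [hx.1]⟩).congr (fun t ht => ?_) fun t ht => ?_
      · rw [R.onEdge_comp ψ ht, coord, if_pos hf]
      · simp only [hf, if_true]
    · refine He.congr (fun t ht => ?_) fun t ht => ?_
      · rw [R.onEdge_comp ψ ht, coord, if_neg hf]
      · simp only [hf]
        rfl
  · rw [← K v]
    simp only [outgoingSum, ← Finset.sum_add_distrib]
    refine Fintype.sum_equiv R.edge _ _ fun e => ?_
    rw [R.src_edge, R.tgt_edge, R.len_edge]
    by_cases hf : R.flip e <;> simp [hf, add_comm]

theorem spec_le (R : Reparam Γ Γ') (r : ℝ) : Γ'.spec r ≤ Γ.spec r := by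
  let T : Γ'.eigenspace r →ₗ[ℝ] Γ.eigenspace r :=
    (LinearMap.funLeft ℝ ℝ R.homeo).restrict fun ψ h => R.comp_mem_eigenspace h
  refine LinearMap.finrank_le_finrank_of_injective (f := T) ?_
  refine (injective_iff_map_eq_zero T).2 fun ψ h => ?_
  by_contra h0
  exact R.ne_zero (fun h' => h0 (Subtype.ext h')) (congrArg Subtype.val h)

theorem spec_eq (R : Reparam Γ Γ') (r : ℝ) : Γ.spec r = Γ'.spec r := le_antisymm (R.symm.spec_le r) (R.spec_le r)

theorem isEigenfunction_comp {r : ℝ} {ψ : Γ'.Space → ℝ} (h : Γ'.IsEigenfunction r ψ) :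
    Γ.IsEigenfunction r (ψ ∘ R.homeo) := ⟨R.comp_mem_eigenspace h.1, R.ne_zero h.2⟩

theorem isGeneric_comp {ψ : Γ'.Space → ℝ} (h : Γ'.IsGeneric ψ) : Γ.IsGeneric (ψ ∘ R.homeo) := by
  obtain ⟨⟨r, h1, h2⟩, h3⟩ := h
  exact ⟨⟨r, R.isEigenfunction_comp h1, (R.spec_eq r).trans h2⟩,
    fun x v hx => h3 _ v (R.atVertex_pt hx)⟩

theorem flipCount_comp (ψ : Γ'.Space → ℝ) : Γ.flipCount (ψ ∘ R.homeo) = Γ'.flipCount ψ := by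
  refine Fintype.sum_equiv R.edge _ _ fun e => ?_
  rw [encard_zeros, encard_zeros,
    ← Function.Injective.encard_image (Function.LeftInverse.injective (R.coord_coord e))]
  congr 1
  ext x
  constructor
  · rintro ⟨t, ⟨ht, h⟩, rfl⟩
    exact ⟨R.coord_mem ht, by rwa [← R.onEdge_comp ψ ht]⟩
  · rintro ⟨hx, h⟩
    have hx' : R.coord e x ∈ Set.Icc 0 (Γ.len e) := by
      rw [R.len_edge] at hx
      rw [coord]
      split_ifs
      · exact ⟨by linarith [hx.2], by linarith [hx.1]⟩
      · exact hx
    exact ⟨R.coord e x, ⟨hx', by rwa [R.onEdge_comp ψ hx', coord_coord]⟩, R.coord_coord e x⟩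

end Reparam

end MetricGraph

/-- The rank–nullity formula for a functional on a submodule, the kernel being described inside the
ambient module. -/
theorem Submodule.finrank_eq_range_add {M F : Type*} [AddCommGroup M] [Module ℝ M]
    [AddCommGroup F] [Module ℝ F] {W W' : Submodule ℝ M} [FiniteDimensional ℝ W] (T : W →ₗ[ℝ] F)
    (hle : W' ≤ W) (h : ∀ x (hx : x ∈ W), T ⟨x, hx⟩ = 0 ↔ x ∈ W') :
    Module.finrank ℝ W = Module.finrank ℝ W' + Module.finrank ℝ (LinearMap.range T) := by
  have hk : (LinearMap.ker T).map W.subtype = W' := by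
    ext x
    constructor
    · rintro ⟨⟨y, hy⟩, hT, rfl⟩
      exact (h y hy).1 hT
    · intro hx
      exact ⟨⟨x, hle hx⟩, (h x (hle hx)).2 hx, rfl⟩
  rw [← hk, Submodule.finrank_map_subtype_eq, add_comm,
    T.finrank_range_add_finrank_ker]

open Classical in
/-- The line `ℝ` if `p` holds, and zero otherwise. -/
noncomputable def lineIf (p : Prop) : Submodule ℝ ℝ := if p then ⊤ else ⊥

theorem mem_lineIf {p : Prop} {x : ℝ} : x ∈ lineIf p ↔ (x ≠ 0 → p) := by
  by_cases h : p <;> simp [lineIf, h]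

theorem finrank_lineIf_of_not {p : Prop} (h : ¬p) : Module.finrank ℝ (lineIf p) = 0 := by
  rw [lineIf, if_neg h, finrank_bot]

theorem finrank_lineIf_le (p : Prop) : Module.finrank ℝ (lineIf p) ≤ 1 := by
  simpa using Submodule.finrank_le (lineIf p)

namespace MetricGraph

/-! ### Attaching a leaf pair, plain or glued -/

/-- A vertex `root` of `G` and two isolated vertices `tip i`, where two leaves can be attached. -/
structure LeafSite {V E : Type*} (G : MetricGraph V E) where
  root : V
  tip : Bool → V
  tip_injective : Function.Injective tip
  tip_ne_root : ∀ i, tip i ≠ root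
  src_ne_tip : ∀ e i, G.src e ≠ tip i
  tgt_ne_tip : ∀ e i, G.tgt e ≠ tip i

namespace LeafSite

variable {V E : Type*} {G : MetricGraph V E} (S : G.LeafSite) {d l : ℝ}

/-- The graph `G` with two leaves of length `l` attached: the leaf `Sum.inr i` runs from the root
to `S.tip i`. -/
def leafGraph (hl : 0 < l) : MetricGraph V (E ⊕ Bool) where
  src
    | .inl e => G.src e
    | .inr _ => S.root
  tgt
    | .inl e => G.tgt e
    | .inr i => S.tip i
  len
    | .inl e => G.len e
    | .inr _ => l
  len_pos
    | .inl e => G.len_pos e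
    | .inr _ => hl

/-- The graph `G` with a glued leaf pair attached: the inner edges `Sum.inr (Sum.inl i)` of length
`d` run from the root to the new vertex `none`, and the outer edges `Sum.inr (Sum.inr i)` of
length `l - d` run from there to the tips. -/
def gluedGraph (hd : d ∈ Set.Ioo 0 l) : MetricGraph (Option V) (E ⊕ (Bool ⊕ Bool)) where
  src
    | .inl e => some (G.src e)
    | .inr (.inl _) => some S.root
    | .inr (.inr _) => none
  tgt
    | .inl e => some (G.tgt e)
    | .inr (.inl _) => none
    | .inr (.inr i) => some (S.tip i)
  len
    | .inl e => G.len e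
    | .inr (.inl _) => d
    | .inr (.inr _) => l - d
  len_pos
    | .inl e => G.len_pos e
    | .inr (.inl _) => hd.1
    | .inr (.inr _) => sub_pos.2 hd.2

section kirchhoff

variable [Fintype E]

theorem outgoingSum_tip (g : E → ℝ → ℝ) (i : Bool) : G.outgoingSum g (S.tip i) = 0 := by
  simp [outgoingSum, S.src_ne_tip, S.tgt_ne_tip]

open Classical in
theorem leafGraph_kirchhoff_iff (hl : 0 < l) (g : E ⊕ Bool → ℝ → ℝ) :
    (∀ v, (S.leafGraph hl).outgoingSum g v = 0) ↔ (∀ i, g (.inr i) l = 0) ∧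
      ∀ v, G.outgoingSum (fun e => g (.inl e)) v +
        (if S.root = v then g (.inr true) 0 + g (.inr false) 0 else 0) = 0 := by
  have key : ∀ v, (S.leafGraph hl).outgoingSum g v = G.outgoingSum (fun e => g (.inl e)) v +
      (if S.root = v then g (.inr true) 0 + g (.inr false) 0 else 0) +
      ((if S.tip true = v then -g (.inr true) l else 0) +
        if S.tip false = v then -g (.inr false) l else 0) := by
    intro v
    simp only [outgoingSum, Fintype.sum_sum_type, Fintype.sum_bool]
    change ((∑ e, if G.src e = v then g (.inl e) 0 else 0) +
        ((if S.root = v then g (.inr true) 0 else 0) + if S.root = v then g (.inr false) 0 else 0)) +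
      ((∑ e, if G.tgt e = v then -g (.inl e) (G.len e) else 0) +
        ((if S.tip true = v then -g (.inr true) l else 0) +
          if S.tip false = v then -g (.inr false) l else 0)) = _
    by_cases h : S.root = v <;> simp only [h, if_true, if_false] <;> ring
  constructor
  · intro h
    have ht : ∀ i, g (.inr i) l = 0 := by
      intro i
      have := h (S.tip i)
      rw [key, S.outgoingSum_tip, if_neg (S.tip_ne_root i).symm] at this
      cases i <;> simpa [S.tip_injective.eq_iff] using this
    exact ⟨ht, fun v => by simpa [key, ht] using h v⟩
  · rintro ⟨ht, h⟩ v
    simpa [key, ht] using h v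

open Classical in
theorem gluedGraph_kirchhoff_iff (hd : d ∈ Set.Ioo 0 l) (g : E ⊕ (Bool ⊕ Bool) → ℝ → ℝ) :
    (∀ v, (S.gluedGraph hd).outgoingSum g v = 0) ↔ (∀ i, g (.inr (.inr i)) (l - d) = 0) ∧
      g (.inr (.inl true)) d + g (.inr (.inl false)) d =
        g (.inr (.inr true)) 0 + g (.inr (.inr false)) 0 ∧
      ∀ v, G.outgoingSum (fun e => g (.inl e)) v +
        (if S.root = v then g (.inr (.inl true)) 0 + g (.inr (.inl false)) 0 else 0) = 0 := by
  have key : ∀ v, (S.gluedGraph hd).outgoingSum g (some v) =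
      G.outgoingSum (fun e => g (.inl e)) v +
      (if S.root = v then g (.inr (.inl true)) 0 + g (.inr (.inl false)) 0 else 0) +
      ((if S.tip true = v then -g (.inr (.inr true)) (l - d) else 0) +
        if S.tip false = v then -g (.inr (.inr false)) (l - d) else 0) := by
    intro v
    simp only [outgoingSum, gluedGraph, Fintype.sum_sum_type, Fintype.sum_bool, Option.some_inj,
      reduceCtorEq, if_false]
    split_ifs <;> ring
  have key' : (S.gluedGraph hd).outgoingSum g none =
      g (.inr (.inr true)) 0 + g (.inr (.inr false)) 0 -
        (g (.inr (.inl true)) d + g (.inr (.inl false)) d) := by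
    simp only [outgoingSum, gluedGraph, Fintype.sum_sum_type, Fintype.sum_bool,
      reduceCtorEq, if_false, if_true, Finset.sum_const_zero]
    ring
  constructor
  · intro h
    have ht : ∀ i, g (.inr (.inr i)) (l - d) = 0 := by
      intro i
      have := h (some (S.tip i))
      rw [key, S.outgoingSum_tip, if_neg (S.tip_ne_root i).symm] at this
      cases i <;> simpa [S.tip_injective.eq_iff] using this
    refine ⟨ht, ?_, fun v => by simpa [key, ht] using h (some v)⟩
    have := h none
    rw [key'] at this
    linarith
  · rintro ⟨ht, hw, h⟩ (_ | v)
    · rw [key']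
      linarith
    · simpa [key, ht] using h v

end kirchhoff

/-! ### The gluing map -/

/-- The edge point of the graph with plain leaves that corresponds to an edge point of the graph
with glued leaves. -/
def unglue (hd : d ∈ Set.Ioo 0 l) :
    (S.gluedGraph hd).EdgePoint → (S.leafGraph (hd.1.trans hd.2)).EdgePoint
  | ⟨.inl e, t⟩ => ⟨.inl e, t⟩
  | ⟨.inr (.inl i), t⟩ => ⟨.inr i, t, t.2.1, t.2.2.trans hd.2.le⟩
  | ⟨.inr (.inr i), t⟩ => ⟨.inr i, d + t, add_nonneg hd.1.le t.2.1, by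
      have h : (t : ℝ) ≤ l - d := t.2.2
      change d + (t : ℝ) ≤ l
      linarith⟩

variable (hd : d ∈ Set.Ioo 0 l)

theorem continuous_unglue : Continuous (S.unglue hd) := by
  refine continuous_sigma fun e => ?_
  rcases e with e | i | i
  · exact continuous_sigmaMk
      (σ := fun e => Set.Icc (0 : ℝ) ((S.leafGraph (hd.1.trans hd.2)).len e)) (i := .inl e)
  · refine (continuous_sigmaMk
      (σ := fun e => Set.Icc (0 : ℝ) ((S.leafGraph (hd.1.trans hd.2)).len e)) (i := .inr i)).comp ?_
    exact Continuous.subtype_mk continuous_subtype_val _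
  · refine (continuous_sigmaMk
      (σ := fun e => Set.Icc (0 : ℝ) ((S.leafGraph (hd.1.trans hd.2)).len e)) (i := .inr i)).comp ?_
    exact Continuous.subtype_mk (continuous_const.add continuous_subtype_val) _

theorem unglue_surjective : Function.Surjective (S.unglue hd) := by
  rintro ⟨e | i, t⟩
  · exact ⟨⟨.inl e, t⟩, rfl⟩
  · by_cases h : (t : ℝ) ≤ d
    · exact ⟨⟨.inr (.inl i), t, t.2.1, h⟩, rfl⟩
    · have h' : (t : ℝ) ≤ l := t.2.2
      refine ⟨⟨.inr (.inr i), t - d, sub_nonneg.2 (not_le.1 h).le, sub_le_sub_right h' d⟩, ?_⟩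
      exact EdgePoint.ext rfl (add_sub_cancel d (t : ℝ))

theorem atVertex_unglue {y : (S.gluedGraph hd).EdgePoint} {v : V}
    (h : (S.gluedGraph hd).AtVertex y (some v)) :
    (S.leafGraph (hd.1.trans hd.2)).AtVertex (S.unglue hd y) v := by
  obtain ⟨e | i | i, t⟩ := y
  · simpa [AtVertex, unglue, gluedGraph, leafGraph] using h
  · obtain ⟨h0, h1⟩ : (t : ℝ) = 0 ∧ S.root = v := by simpa [AtVertex, gluedGraph] using h
    exact Or.inl ⟨h0, h1⟩
  · obtain ⟨h0, h1⟩ : (t : ℝ) = l - d ∧ S.tip i = v := by simpa [AtVertex, gluedGraph] using h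
    refine Or.inr ⟨?_, h1⟩
    change d + (t : ℝ) = l
    linarith

theorem atVertex_of_unglue {y : (S.gluedGraph hd).EdgePoint} {v : V}
    (h : (S.leafGraph (hd.1.trans hd.2)).AtVertex (S.unglue hd y) v) :
    (S.gluedGraph hd).AtVertex y (some v) := by
  obtain ⟨h0, h1⟩ := hd
  obtain ⟨e | i | i, t⟩ := y
  · simpa [AtVertex, unglue, gluedGraph, leafGraph] using h
  · have ht : (t : ℝ) ≤ d := t.2.2
    rcases h with ⟨a, b⟩ | ⟨a, b⟩
    · exact Or.inl ⟨a, congrArg some b⟩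
    · change (t : ℝ) = l at a
      linarith
  · have ht : 0 ≤ (t : ℝ) := t.2.1
    rcases h with ⟨a, b⟩ | ⟨a, b⟩
    · change d + (t : ℝ) = 0 at a
      linarith
    · change d + (t : ℝ) = l at a
      refine Or.inr ⟨?_, congrArg some b⟩
      change (t : ℝ) = l - d
      linarith

/-- The point of the leaf `i` that is glued. -/
def gluePoint (i : Bool) : (S.leafGraph (hd.1.trans hd.2)).Space :=
  (S.leafGraph (hd.1.trans hd.2)).point (.inr i) ⟨d, hd.1.le, hd.2.le⟩

theorem unglue_of_atVertex_none {y : (S.gluedGraph hd).EdgePoint}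
    (h : (S.gluedGraph hd).AtVertex y none) : ∃ i, S.unglue hd y = ⟨.inr i, d, hd.1.le, hd.2.le⟩ := by
  obtain ⟨e | i | i, t⟩ := y
  · simp [AtVertex, gluedGraph] at h
  · have h0 : (t : ℝ) = d := by simpa [AtVertex, gluedGraph] using h
    exact ⟨i, EdgePoint.ext rfl h0⟩
  · have h0 : (t : ℝ) = 0 := by simpa [AtVertex, gluedGraph] using h
    refine ⟨i, EdgePoint.ext rfl ?_⟩
    change d + (t : ℝ) = d
    rw [h0, add_zero]

theorem atVertex_none_of_unglue {y : (S.gluedGraph hd).EdgePoint} {i : Bool}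
    (h : S.unglue hd y = ⟨.inr i, d, hd.1.le, hd.2.le⟩) : (S.gluedGraph hd).AtVertex y none := by
  obtain ⟨e | j | j, t⟩ := y
  · exact absurd (congrArg Sigma.fst h) Sum.inl_ne_inr
  · have h' : (t : ℝ) = d := congrArg (fun x => (x.2 : ℝ)) h
    exact Or.inr ⟨h', rfl⟩
  · have h' : d + (t : ℝ) = d := congrArg (fun x => (x.2 : ℝ)) h
    exact Or.inl ⟨by simpa using h', rfl⟩

theorem mk_eq_of_unglue {y z : (S.gluedGraph hd).EdgePoint} (h : S.unglue hd y = S.unglue hd z) :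
    (S.gluedGraph hd).point y.1 y.2 = (S.gluedGraph hd).point z.1 z.2 := by
  by_cases hy : ∃ i, S.unglue hd y = ⟨.inr i, d, hd.1.le, hd.2.le⟩
  · obtain ⟨i, hi⟩ := hy
    exact Quot.sound ⟨none, S.atVertex_none_of_unglue hd hi, S.atVertex_none_of_unglue hd (h ▸ hi)⟩
  · suffices y = z by rw [this]
    have h1 : (S.unglue hd y).1 = (S.unglue hd z).1 := congrArg Sigma.fst h
    have h2 : ((S.unglue hd y).2 : ℝ) = (S.unglue hd z).2 := congrArg (fun x => (x.2 : ℝ)) h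
    obtain ⟨e | i | i, t⟩ := y <;> obtain ⟨e' | j | j, t'⟩ := z
    · exact EdgePoint.ext (congrArg Sum.inl (Sum.inl_injective h1)) h2
    · exact absurd h1 Sum.inl_ne_inr
    · exact absurd h1 Sum.inl_ne_inr
    · exact absurd h1 Sum.inr_ne_inl
    · obtain rfl : i = j := Sum.inr_injective h1
      exact EdgePoint.ext rfl h2
    · have a : (t : ℝ) ≤ d := t.2.2
      have b : 0 ≤ (t' : ℝ) := t'.2.1
      have c : (t : ℝ) = d + t' := h2
      exact absurd ⟨i, EdgePoint.ext rfl (by change (t : ℝ) = d; linarith)⟩ hy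
    · exact absurd h1 Sum.inr_ne_inl
    · have a : (t' : ℝ) ≤ d := t'.2.2
      have b : 0 ≤ (t : ℝ) := t.2.1
      have c : d + (t : ℝ) = t' := h2
      exact absurd ⟨i, EdgePoint.ext rfl (by change d + (t : ℝ) = d; linarith)⟩ hy
    · obtain rfl : i = j := Sum.inr_injective h1
      exact EdgePoint.ext rfl (add_left_cancel (a := d) h2)

/-- The gluing map, which identifies the two glue points. -/
noncomputable def glueMap : (S.leafGraph (hd.1.trans hd.2)).Space → (S.gluedGraph hd).Space :=
  Quot.lift (fun x => Quot.mk _ (Function.surjInv (S.unglue_surjective hd) x)) (by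
    rintro x y ⟨v, hx, hy⟩
    rw [← Function.surjInv_eq (S.unglue_surjective hd) x] at hx
    rw [← Function.surjInv_eq (S.unglue_surjective hd) y] at hy
    exact Quot.sound ⟨some v, S.atVertex_of_unglue hd hx, S.atVertex_of_unglue hd hy⟩)

theorem glueMap_unglue (y : (S.gluedGraph hd).EdgePoint) :
    S.glueMap hd (Quot.mk _ (S.unglue hd y)) = Quot.mk _ y :=
  S.mk_eq_of_unglue hd (Function.surjInv_eq (S.unglue_surjective hd) _)

theorem glueMap_surjective : Function.Surjective (S.glueMap hd) := by
  rintro ⟨y⟩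
  exact ⟨_, S.glueMap_unglue hd y⟩

theorem eq_of_glueMap_eq {p q : (S.leafGraph (hd.1.trans hd.2)).Space}
    (h : S.glueMap hd p = S.glueMap hd q) :
    p = q ∨ (∃ i, p = S.gluePoint hd i) ∧ ∃ j, q = S.gluePoint hd j := by
  obtain ⟨x, rfl⟩ := Quot.exists_rep p
  obtain ⟨x', rfl⟩ := Quot.exists_rep q
  obtain ⟨y, rfl⟩ := S.unglue_surjective hd x
  obtain ⟨z, rfl⟩ := S.unglue_surjective hd x'
  rw [glueMap_unglue, glueMap_unglue] at h
  rcases mk_eq_mk_iff.1 h with rfl | ⟨_ | v, hy, hz⟩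
  · exact Or.inl rfl
  · right
    obtain ⟨i, hi⟩ := S.unglue_of_atVertex_none hd hy
    obtain ⟨j, hj⟩ := S.unglue_of_atVertex_none hd hz
    exact ⟨⟨i, congrArg (Quot.mk _) hi⟩, ⟨j, congrArg (Quot.mk _) hj⟩⟩
  · exact Or.inl (Quot.sound ⟨v, S.atVertex_unglue hd hy, S.atVertex_unglue hd hz⟩)

theorem glueMap_gluePoint (i j : Bool) :
    S.glueMap hd (S.gluePoint hd i) = S.glueMap hd (S.gluePoint hd j) := by
  have h : ∀ i, S.gluePoint hd i =
      Quot.mk _ (S.unglue hd ⟨.inr (.inl i), d, hd.1.le, le_rfl⟩) := fun i => rfl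
  rw [h, h, glueMap_unglue, glueMap_unglue]
  exact Quot.sound ⟨none, Or.inr ⟨rfl, rfl⟩, Or.inr ⟨rfl, rfl⟩⟩

theorem isQuotientMap_glueMap [Fintype E] : Topology.IsQuotientMap (S.glueMap hd) := by
  have h1 : Topology.IsQuotientMap (S.unglue hd) :=
    (S.continuous_unglue hd).isClosedMap.isQuotientMap (S.continuous_unglue hd)
      (S.unglue_surjective hd)
  have h2 : Topology.IsQuotientMap fun y => (Quot.mk _ (S.unglue hd y) :
      (S.leafGraph (hd.1.trans hd.2)).Space) := isQuotientMap_quot_mk.comp h1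
  have h3 : S.glueMap hd ∘ (fun y => (Quot.mk _ (S.unglue hd y) :
      (S.leafGraph (hd.1.trans hd.2)).Space)) = Quot.mk _ := funext (S.glueMap_unglue hd)
  have h4 : Continuous (S.glueMap hd) := h2.continuous_iff.2 (h3 ▸ continuous_quot_mk)
  exact Topology.IsQuotientMap.of_comp h2.continuous h4 (h3 ▸ isQuotientMap_quot_mk)

theorem onEdge_comp_glueMap (ψ : (S.gluedGraph hd).Space → ℝ) (y : (S.gluedGraph hd).EdgePoint) :
    (S.leafGraph (hd.1.trans hd.2)).onEdge (ψ ∘ S.glueMap hd) (S.unglue hd y).1 (S.unglue hd y).2 =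
      (S.gluedGraph hd).onEdge ψ y.1 y.2 := by
  rw [onEdge_coe, onEdge_coe]
  exact congrArg ψ (S.glueMap_unglue hd y)

theorem onEdge_comp_core (ψ : (S.gluedGraph hd).Space → ℝ) (e : E) {t : ℝ}
    (ht : t ∈ Set.Icc 0 (G.len e)) :
    (S.leafGraph (hd.1.trans hd.2)).onEdge (ψ ∘ S.glueMap hd) (.inl e) t =
      (S.gluedGraph hd).onEdge ψ (.inl e) t := S.onEdge_comp_glueMap hd ψ ⟨.inl e, t, ht⟩

theorem onEdge_comp_inner (ψ : (S.gluedGraph hd).Space → ℝ) (i : Bool) {t : ℝ}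
    (ht : t ∈ Set.Icc 0 d) :
    (S.leafGraph (hd.1.trans hd.2)).onEdge (ψ ∘ S.glueMap hd) (.inr i) t =
      (S.gluedGraph hd).onEdge ψ (.inr (.inl i)) t :=
  S.onEdge_comp_glueMap hd ψ ⟨.inr (.inl i), t, ht⟩

theorem onEdge_comp_outer (ψ : (S.gluedGraph hd).Space → ℝ) (i : Bool) {t : ℝ}
    (ht : t ∈ Set.Icc 0 (l - d)) :
    (S.leafGraph (hd.1.trans hd.2)).onEdge (ψ ∘ S.glueMap hd) (.inr i) (d + t) =
      (S.gluedGraph hd).onEdge ψ (.inr (.inr i)) t :=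
  S.onEdge_comp_glueMap hd ψ ⟨.inr (.inr i), t, ht⟩

end LeafSite

end MetricGraph

namespace MetricGraph

/-- The difference of the values at two points, as a linear functional. -/
def evalSub {X : Type*} (W : Submodule ℝ (X → ℝ)) (p q : X) : W →ₗ[ℝ] ℝ where
  toFun ψ := ψ.1 p - ψ.1 q
  map_add' ψ φ := add_sub_add_comm (ψ.1 p) (φ.1 p) (ψ.1 q) (φ.1 q)
  map_smul' c ψ := (mul_sub c (ψ.1 p) (ψ.1 q)).symm

namespace LeafSite

variable {V E : Type*} {G : MetricGraph V E} (S : G.LeafSite) {d l r : ℝ}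

/-! ### The spectra of the two graphs -/

/-- The functions that take the same values on the two leaves. -/
def symmetric (hl : 0 < l) : Submodule ℝ ((S.leafGraph hl).Space → ℝ) where
  carrier := {ψ | ∀ t : Set.Icc 0 l, ψ ((S.leafGraph hl).point (.inr true) t) =
    ψ ((S.leafGraph hl).point (.inr false) t)}
  zero_mem' _ := rfl
  add_mem' h h' t := congrArg₂ (· + ·) (h t) (h' t)
  smul_mem' c _ h t := congrArg (c * ·) (h t)

theorem mem_symmetric {hl : 0 < l} {ψ : (S.leafGraph hl).Space → ℝ} :
    ψ ∈ S.symmetric hl ↔ ∀ t ∈ Set.Icc 0 l, (S.leafGraph hl).onEdge ψ (.inr true) t =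
      (S.leafGraph hl).onEdge ψ (.inr false) t := by
  constructor
  · intro h t ht
    rw [onEdge_of_mem (Γ := S.leafGraph hl) ψ (.inr true) ht,
      onEdge_of_mem (Γ := S.leafGraph hl) ψ (.inr false) ht]
    exact h ⟨t, ht⟩
  · intro h t
    have := h t t.2
    rwa [onEdge_of_mem (Γ := S.leafGraph hl) ψ (.inr true) t.2,
      onEdge_of_mem (Γ := S.leafGraph hl) ψ (.inr false) t.2] at this

section pullback

variable (hd : d ∈ Set.Ioo 0 l)

/-- Pulling back along the gluing map, as a linear map on functions. -/
noncomputable def pullback : ((S.gluedGraph hd).Space → ℝ) →ₗ[ℝ]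
    ((S.leafGraph (hd.1.trans hd.2)).Space → ℝ) := LinearMap.funLeft ℝ ℝ (S.glueMap hd)

theorem pullback_injective : Function.Injective (S.pullback hd) :=
  LinearMap.funLeft_injective_of_surjective ℝ ℝ _ (S.glueMap_surjective hd)

theorem pullback_mem_symmetric {ψ : (S.gluedGraph hd).Space → ℝ} :
    S.pullback hd ψ ∈ S.symmetric (hd.1.trans hd.2) ↔
      (∀ t ∈ Set.Icc 0 d, (S.gluedGraph hd).onEdge ψ (.inr (.inl true)) t =
        (S.gluedGraph hd).onEdge ψ (.inr (.inl false)) t) ∧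
      ∀ t ∈ Set.Icc 0 (l - d), (S.gluedGraph hd).onEdge ψ (.inr (.inr true)) t =
        (S.gluedGraph hd).onEdge ψ (.inr (.inr false)) t := by
  obtain ⟨h1, h2⟩ := id hd
  rw [mem_symmetric]
  constructor
  · intro h
    refine ⟨fun t ht => ?_, fun t ht => ?_⟩
    · rw [← S.onEdge_comp_inner hd ψ _ ht, ← S.onEdge_comp_inner hd ψ _ ht]
      exact h t ⟨ht.1, ht.2.trans h2.le⟩
    · rw [← S.onEdge_comp_outer hd ψ _ ht, ← S.onEdge_comp_outer hd ψ _ ht]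
      exact h _ ⟨by linarith [ht.1], by linarith [ht.2]⟩
  · rintro ⟨h, h'⟩ t ⟨ht0, ht1⟩
    rcases le_total t d with htd | htd
    · exact (S.onEdge_comp_inner hd ψ _ ⟨ht0, htd⟩).trans ((h t ⟨ht0, htd⟩).trans
        (S.onEdge_comp_inner hd ψ _ ⟨ht0, htd⟩).symm)
    · have hm : t - d ∈ Set.Icc 0 (l - d) := ⟨by linarith, by linarith⟩
      have := (S.onEdge_comp_outer hd ψ _ hm).trans ((h' _ hm).trans
        (S.onEdge_comp_outer hd ψ _ hm).symm)
      rwa [add_sub_cancel] at this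

theorem exists_pullback_eq {ψ : (S.leafGraph (hd.1.trans hd.2)).Space → ℝ}
    (h : ψ ∈ S.symmetric (hd.1.trans hd.2)) : ∃ φ, S.pullback hd φ = ψ := by
  refine ⟨fun q => ψ (Function.surjInv (S.glueMap_surjective hd) q), funext fun p => ?_⟩
  have h0 : ∀ i, ψ (S.gluePoint hd i) = ψ (S.gluePoint hd true) := by
    rintro (_ | _)
    · exact (h ⟨d, hd.1.le, hd.2.le⟩).symm
    · rfl
  change ψ (Function.surjInv (S.glueMap_surjective hd) (S.glueMap hd p)) = ψ p
  rcases S.eq_of_glueMap_eq hd (Function.surjInv_eq (S.glueMap_surjective hd) (S.glueMap hd p))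
    with h' | ⟨⟨i, hi⟩, ⟨j, hj⟩⟩
  · rw [h']
  · rw [hi, hj, h0, h0 j]

end pullback

section eigen

variable [Fintype E]

open Classical in
theorem mem_leaf_eigenspace {hl : 0 < l} {ψ : (S.leafGraph hl).Space → ℝ} :
    ψ ∈ (S.leafGraph hl).eigenspace r ↔ ∃ g : E ⊕ Bool → ℝ → ℝ,
      (∀ e, SolOn r (Set.Icc 0 (G.len e)) ((S.leafGraph hl).onEdge ψ (.inl e)) (g (.inl e))) ∧
      (∀ i, SolOn r (Set.Icc 0 l) ((S.leafGraph hl).onEdge ψ (.inr i)) (g (.inr i))) ∧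
      (∀ i, g (.inr i) l = 0) ∧
      ∀ v, G.outgoingSum (fun e => g (.inl e)) v +
        (if S.root = v then g (.inr true) 0 + g (.inr false) 0 else 0) = 0 := by
  rw [mem_eigenspace_iff]
  refine exists_congr fun g => ?_
  rw [S.leafGraph_kirchhoff_iff, Sum.forall, and_assoc]
  rfl

open Classical in
theorem mem_glued_eigenspace {hd : d ∈ Set.Ioo 0 l} {ψ : (S.gluedGraph hd).Space → ℝ} :
    ψ ∈ (S.gluedGraph hd).eigenspace r ↔ ∃ g : E ⊕ (Bool ⊕ Bool) → ℝ → ℝ,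
      (∀ e, SolOn r (Set.Icc 0 (G.len e)) ((S.gluedGraph hd).onEdge ψ (.inl e)) (g (.inl e))) ∧
      (∀ i, SolOn r (Set.Icc 0 d) ((S.gluedGraph hd).onEdge ψ (.inr (.inl i)))
        (g (.inr (.inl i)))) ∧
      (∀ i, SolOn r (Set.Icc 0 (l - d)) ((S.gluedGraph hd).onEdge ψ (.inr (.inr i)))
        (g (.inr (.inr i)))) ∧
      (∀ i, g (.inr (.inr i)) (l - d) = 0) ∧
      g (.inr (.inl true)) d + g (.inr (.inl false)) d =
        g (.inr (.inr true)) 0 + g (.inr (.inr false)) 0 ∧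
      ∀ v, G.outgoingSum (fun e => g (.inl e)) v +
        (if S.root = v then g (.inr (.inl true)) 0 + g (.inr (.inl false)) 0 else 0) = 0 := by
  rw [mem_eigenspace_iff]
  refine exists_congr fun g => ?_
  rw [S.gluedGraph_kirchhoff_iff, Sum.forall, Sum.forall, and_assoc, and_assoc]
  rfl

theorem outgoingSum_zero (v : V) : G.outgoingSum (fun _ _ => 0) v = 0 := by simp [outgoingSum]

/-- A Dirichlet–Neumann mode, taken with opposite signs on the two leaves, is an eigenfunction. -/
theorem exists_odd_leaf (hl : 0 < l) (h : HasDirichletNeumannMode r l) :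
    ∃ ψ ∈ (S.leafGraph hl).eigenspace r,
      (S.leafGraph hl).onEdge ψ (.inr true) l - (S.leafGraph hl).onEdge ψ (.inr false) l ≠ 0 := by
  classical
  obtain ⟨f, g, H, f0, gl, fl⟩ := h
  let sgn : Bool → ℝ := fun i => if i then 1 else -1
  let u : V → ℝ := fun v => if v = S.tip true then f l else if v = S.tip false then -f l else 0
  have hu : ∀ v, (∀ i, v ≠ S.tip i) → u v = 0 := fun v hv => by simp [u, hv]
  have hft : S.tip false ≠ S.tip true := S.tip_injective.ne (by simp)
  let F : E ⊕ Bool → ℝ → ℝ := Sum.elim (fun _ _ => 0) fun i t => sgn i * f t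
  let ψ := (S.leafGraph hl).ofEdges F u
    (by
      rintro (e | i)
      · exact (hu _ (S.src_ne_tip e)).symm
      · exact (by simp [F, f0] : F (.inr i) 0 = 0).trans
          (hu _ fun i => (S.tip_ne_root i).symm).symm)
    (by
      rintro (e | i)
      · exact (hu _ (S.tgt_ne_tip e)).symm
      · change sgn i * f l = u (S.tip i)
        cases i <;> simp [sgn, u, hft])
  have hψ : ∀ i, ∀ t ∈ Set.Icc 0 l, (S.leafGraph hl).onEdge ψ (.inr i) t = sgn i * f t :=
    fun i t ht => onEdge_ofEdges (Γ := S.leafGraph hl) (.inr i) ht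
  refine ⟨ψ, S.mem_leaf_eigenspace.2
    ⟨Sum.elim (fun _ _ => 0) fun i t => sgn i * g t, fun e => ?_, fun i => ?_, ?_, ?_⟩, ?_⟩
  · exact (SolOn.zero r _).congr (fun t ht => onEdge_ofEdges (Γ := S.leafGraph hl) (.inl e) ht)
      fun _ _ => rfl
  · exact (H.smul (sgn i)).congr (hψ i) fun _ _ => rfl
  · simp [gl]
  · intro v
    simp [sgn, outgoingSum_zero]
  · rw [hψ _ l ⟨hl.le, le_rfl⟩, hψ _ l ⟨hl.le, le_rfl⟩]
    intro h
    apply fl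
    simp only [sgn, if_true, Bool.false_eq_true, if_false] at h
    linarith

/-- The antisymmetric part on the leaves satisfies a Dirichlet condition at the root and a Neumann
condition at the tip. -/
theorem odd_part_leaf {hl : 0 < l} {ψ : (S.leafGraph hl).Space → ℝ}
    (h : ψ ∈ (S.leafGraph hl).eigenspace r) :
    ∃ g, SolOn r (Set.Icc 0 l) (fun t => (S.leafGraph hl).onEdge ψ (.inr true) t -
      (S.leafGraph hl).onEdge ψ (.inr false) t) g ∧ g l = 0 ∧
      (S.leafGraph hl).onEdge ψ (.inr true) 0 - (S.leafGraph hl).onEdge ψ (.inr false) 0 = 0 := by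
  obtain ⟨g, -, H, gl, -⟩ := S.mem_leaf_eigenspace.1 h
  obtain ⟨u, -, h0, -⟩ := exists_vertexValue ψ
  refine ⟨_, (H true).sub (H false), by rw [gl, gl, sub_zero], ?_⟩
  exact sub_eq_zero.2 ((h0 (.inr true)).trans (h0 (.inr false)).symm)

theorem finrank_leaf (hl : 0 < l) : (S.leafGraph hl).spec r =
    Module.finrank ℝ ((S.leafGraph hl).eigenspace r ⊓ S.symmetric hl : Submodule ℝ _) +
      Module.finrank ℝ (lineIf (HasDirichletNeumannMode r l)) := by
  have hm : l ∈ Set.Icc 0 l := ⟨hl.le, le_rfl⟩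
  let T : (S.leafGraph hl).eigenspace r →ₗ[ℝ] ℝ :=
    evalSub _ ((S.leafGraph hl).point (.inr true) ⟨l, hm⟩)
      ((S.leafGraph hl).point (.inr false) ⟨l, hm⟩)
  have hT : ∀ ψ h, T ⟨ψ, h⟩ =
      (S.leafGraph hl).onEdge ψ (.inr true) l - (S.leafGraph hl).onEdge ψ (.inr false) l := by
    intro ψ h
    rw [onEdge_of_mem (Γ := S.leafGraph hl) ψ (.inr true) hm,
      onEdge_of_mem (Γ := S.leafGraph hl) ψ (.inr false) hm]
    rfl
  have hrange : LinearMap.range T = lineIf (HasDirichletNeumannMode r l) := by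
    ext x
    rw [mem_lineIf]
    constructor
    · rintro ⟨⟨ψ, h⟩, rfl⟩ hx
      rw [hT] at hx
      obtain ⟨g, H, gl, h0⟩ := S.odd_part_leaf h
      exact ⟨_, g, H, h0, gl, hx⟩
    · intro hx
      by_cases hx0 : x = 0
      · exact hx0 ▸ Submodule.zero_mem _
      · obtain ⟨ψ, h, hne⟩ := S.exists_odd_leaf hl (hx hx0)
        rw [← hT ψ h] at hne
        exact ⟨(x / T ⟨ψ, h⟩) • ⟨ψ, h⟩, by rw [map_smul, smul_eq_mul, div_mul_cancel₀ _ hne]⟩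
  rw [← hrange]
  refine Submodule.finrank_eq_range_add T inf_le_left fun ψ h => ?_
  rw [hT, Submodule.mem_inf, and_iff_right h, mem_symmetric]
  refine ⟨fun h0 t ht => ?_, fun h' => sub_eq_zero.2 (h' l hm)⟩
  obtain ⟨g, H, gl, -⟩ := S.odd_part_leaf h
  exact sub_eq_zero.1 (H.eq_zero hm h0 gl ht).1

variable (hd : d ∈ Set.Ioo 0 l)

open Classical in
/-- There is an eigenfunction of the glued graph with the profiles `f` and `f'` (and their negatives) on
the inner and outer edges, where one of the two profiles may be zero. -/
theorem exists_odd_glued {f g f' g' : ℝ → ℝ} (H : SolOn r (Set.Icc 0 d) f g) (f0 : f 0 = 0)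
    (fd : f d = 0) (H' : SolOn r (Set.Icc 0 (l - d)) f' g') (f0' : f' 0 = 0)
    (gl' : g' (l - d) = 0) :
    ∃ ψ, ∃ h : ψ ∈ (S.gluedGraph hd).eigenspace r,
      (S.gluedGraph hd).startDeriv r (.inr (.inl true)) ⟨ψ, h⟩ -
        (S.gluedGraph hd).startDeriv r (.inr (.inl false)) ⟨ψ, h⟩ = 2 * g 0 ∧
      (S.gluedGraph hd).onEdge ψ (.inr (.inr true)) (l - d) -
        (S.gluedGraph hd).onEdge ψ (.inr (.inr false)) (l - d) = 2 * f' (l - d) ∧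
      (S.gluedGraph hd).onEdge ψ (.inr (.inl true)) 0 = 0 := by
  have hd1 := hd.1.le
  have hd2 := sub_nonneg.2 hd.2.le
  let sgn : Bool → ℝ := fun i => if i then 1 else -1
  let u : Option V → ℝ := fun v => if v = some (S.tip true) then f' (l - d) else
    if v = some (S.tip false) then -f' (l - d) else 0
  have hu : ∀ v, (∀ i, v ≠ S.tip i) → u (some v) = 0 := fun v hv => by simp [u, hv]
  have hu' : u none = 0 := by simp [u]
  have hft : S.tip false ≠ S.tip true := S.tip_injective.ne (by simp)
  let F : E ⊕ (Bool ⊕ Bool) → ℝ → ℝ := Sum.elim (fun _ _ => 0)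
    (Sum.elim (fun i t => sgn i * f t) fun i t => sgn i * f' t)
  let D : E ⊕ (Bool ⊕ Bool) → ℝ → ℝ := Sum.elim (fun _ _ => 0)
    (Sum.elim (fun i t => sgn i * g t) fun i t => sgn i * g' t)
  let ψ := (S.gluedGraph hd).ofEdges F u
    (by
      rintro (e | i | i)
      · exact (hu _ (S.src_ne_tip e)).symm
      · exact (by simp [F, f0] : F (.inr (.inl i)) 0 = 0).trans
          (hu _ fun i => (S.tip_ne_root i).symm).symm
      · exact (by simp [F, f0'] : F (.inr (.inr i)) 0 = 0).trans hu'.symm)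
    (by
      rintro (e | i | i)
      · exact (hu _ (S.tgt_ne_tip e)).symm
      · exact (by simp [F, fd] : F (.inr (.inl i)) d = 0).trans hu'.symm
      · change sgn i * f' (l - d) = u (some (S.tip i))
        cases i <;> simp [sgn, u, hft])
  have hψ : ∀ i, ∀ t ∈ Set.Icc 0 d, (S.gluedGraph hd).onEdge ψ (.inr (.inl i)) t = sgn i * f t :=
    fun i t ht => onEdge_ofEdges (Γ := S.gluedGraph hd) (.inr (.inl i)) ht
  have hψ' : ∀ i, ∀ t ∈ Set.Icc 0 (l - d),
      (S.gluedGraph hd).onEdge ψ (.inr (.inr i)) t = sgn i * f' t :=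
    fun i t ht => onEdge_ofEdges (Γ := S.gluedGraph hd) (.inr (.inr i)) ht
  have hs : ∀ i, SolOn r (Set.Icc 0 d) ((S.gluedGraph hd).onEdge ψ (.inr (.inl i)))
      (D (.inr (.inl i))) := fun i => (H.smul (sgn i)).congr (hψ i) fun _ _ => rfl
  have hmem : ψ ∈ (S.gluedGraph hd).eigenspace r := by
    refine S.mem_glued_eigenspace.2 ⟨D, fun e => ?_, hs, fun i => ?_, ?_, ?_, ?_⟩
    · exact (SolOn.zero r _).congr (fun t ht => onEdge_ofEdges (Γ := S.gluedGraph hd) (.inl e) ht)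
        fun _ _ => rfl
    · exact (H'.smul (sgn i)).congr (hψ' i) fun _ _ => rfl
    · simp [D, gl']
    · simp [D, sgn]
    · intro v
      simp [D, sgn, outgoingSum_zero]
  refine ⟨ψ, hmem, ?_, ?_, ?_⟩
  · rw [startDeriv_eq (Γ := S.gluedGraph hd) (e := .inr (.inl true)) hmem (hs true),
      startDeriv_eq (Γ := S.gluedGraph hd) (e := .inr (.inl false)) hmem (hs false)]
    simp [D, sgn]
    ring
  · rw [hψ' _ _ ⟨hd2, le_rfl⟩, hψ' _ _ ⟨hd2, le_rfl⟩]
    simp [sgn]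
    ring
  · rw [hψ _ _ ⟨le_rfl, hd1⟩, f0, mul_zero]

/-- The antisymmetric part on the inner edges satisfies Dirichlet conditions at both ends; that on
the outer edges satisfies a Dirichlet condition at the new vertex and a Neumann condition at the
tip. -/
theorem odd_part_glued {ψ : (S.gluedGraph hd).Space → ℝ}
    (h : ψ ∈ (S.gluedGraph hd).eigenspace r) :
    (∃ g, SolOn r (Set.Icc 0 d) (fun t => (S.gluedGraph hd).onEdge ψ (.inr (.inl true)) t -
        (S.gluedGraph hd).onEdge ψ (.inr (.inl false)) t) g ∧
      g 0 = (S.gluedGraph hd).startDeriv r (.inr (.inl true)) ⟨ψ, h⟩ -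
        (S.gluedGraph hd).startDeriv r (.inr (.inl false)) ⟨ψ, h⟩ ∧
      (S.gluedGraph hd).onEdge ψ (.inr (.inl true)) 0 -
        (S.gluedGraph hd).onEdge ψ (.inr (.inl false)) 0 = 0 ∧
      (S.gluedGraph hd).onEdge ψ (.inr (.inl true)) d -
        (S.gluedGraph hd).onEdge ψ (.inr (.inl false)) d = 0) ∧
    ∃ g, SolOn r (Set.Icc 0 (l - d)) (fun t => (S.gluedGraph hd).onEdge ψ (.inr (.inr true)) t -
        (S.gluedGraph hd).onEdge ψ (.inr (.inr false)) t) g ∧ g (l - d) = 0 ∧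
      (S.gluedGraph hd).onEdge ψ (.inr (.inr true)) 0 -
        (S.gluedGraph hd).onEdge ψ (.inr (.inr false)) 0 = 0 := by
  obtain ⟨g, -, H, H', gl, -⟩ := S.mem_glued_eigenspace.1 h
  obtain ⟨u, -, h0, h1⟩ := exists_vertexValue ψ
  refine ⟨⟨_, (H true).sub (H false), ?_, ?_, ?_⟩,
    ⟨_, (H' true).sub (H' false), by rw [gl, gl, sub_zero], ?_⟩⟩
  · rw [startDeriv_eq (Γ := S.gluedGraph hd) (e := .inr (.inl true)) h (H true),
      startDeriv_eq (Γ := S.gluedGraph hd) (e := .inr (.inl false)) h (H false)]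
  · exact sub_eq_zero.2 ((h0 (.inr (.inl true))).trans (h0 (.inr (.inl false))).symm)
  · exact sub_eq_zero.2 ((h1 (.inr (.inl true))).trans (h1 (.inr (.inl false))).symm)
  · exact sub_eq_zero.2 ((h0 (.inr (.inr true))).trans (h0 (.inr (.inr false))).symm)

/-- The eigenfunctions of the glued graph that are symmetric under both exchanges pull back to
symmetric eigenfunctions. -/
theorem pullback_mem_eigenspace {ψ : (S.gluedGraph hd).Space → ℝ}
    (h : ψ ∈ (S.gluedGraph hd).eigenspace r)
    (hs : S.pullback hd ψ ∈ S.symmetric (hd.1.trans hd.2)) :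
    S.pullback hd ψ ∈ (S.leafGraph (hd.1.trans hd.2)).eigenspace r := by
  obtain ⟨h1, h2⟩ := id hd
  obtain ⟨s1, s2⟩ := (S.pullback_mem_symmetric hd).1 hs
  obtain ⟨g, H, I, O, gl, K, L⟩ := S.mem_glued_eigenspace.1 h
  have e1 := (I true).deriv_unique h1 (I false) s1 (⟨h1.le, le_rfl⟩ : d ∈ Set.Icc 0 d)
  have e2 := (O true).deriv_unique (sub_pos.2 h2) (O false) s2
    (⟨le_rfl, sub_nonneg.2 h2.le⟩ : (0 : ℝ) ∈ Set.Icc 0 (l - d))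
  -- By symmetry the vertex condition at the new vertex splits evenly over the two leaves.
  have match_deriv : ∀ i, g (.inr (.inl i)) d = g (.inr (.inr i)) 0 := by
    rintro (_ | _) <;> linarith
  refine S.mem_leaf_eigenspace.2 ⟨Sum.elim (fun e => g (.inl e)) fun i t =>
    if t ≤ d then g (.inr (.inl i)) t else g (.inr (.inr i)) (t - d), ?_, ?_, ?_, ?_⟩
  · exact fun e => (H e).congr (fun t ht => S.onEdge_comp_core hd ψ e ht) fun _ _ => rfl
  · intro i
    refine SolOn.union h1.le h2.le ((I i).congr (fun t ht => S.onEdge_comp_inner hd ψ i ht)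
      fun t ht => if_pos ht.2) ?_
    refine ((O i).comp_const_add (t := Set.Icc d l) (-d) fun x hx =>
      ⟨by linarith [hx.1], by linarith [hx.2]⟩).congr (fun t ht => ?_) fun t ht => ?_
    · have hm : -d + t ∈ Set.Icc 0 (l - d) := ⟨by linarith [ht.1], by linarith [ht.2]⟩
      have := S.onEdge_comp_outer hd ψ i hm
      rwa [add_neg_cancel_left] at this
    · simp only [Sum.elim_inr]
      split_ifs with htd
      · obtain rfl : t = d := le_antisymm htd ht.1
        rw [match_deriv, neg_add_cancel]
      · rw [sub_eq_neg_add]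
  · intro i
    simp [h2.not_ge, gl]
  · intro v
    simpa [h1.le] using L v

theorem mem_eigenspace_of_pullback {ψ : (S.gluedGraph hd).Space → ℝ}
    (h : S.pullback hd ψ ∈ (S.leafGraph (hd.1.trans hd.2)).eigenspace r) :
    ψ ∈ (S.gluedGraph hd).eigenspace r := by
  obtain ⟨h1, h2⟩ := id hd
  obtain ⟨g, H, I, gl, L⟩ := S.mem_leaf_eigenspace.1 h
  refine S.mem_glued_eigenspace.2 ⟨Sum.elim (fun e => g (.inl e))
    (Sum.elim (fun i => g (.inr i)) fun i t => g (.inr i) (d + t)), ?_, ?_, ?_, ?_, ?_, ?_⟩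
  · exact fun e => (H e).congr (fun t ht => (S.onEdge_comp_core hd ψ e ht).symm) fun _ _ => rfl
  · exact fun i => ((I i).mono (Set.Icc_subset_Icc_right h2.le)).congr
      (fun t ht => (S.onEdge_comp_inner hd ψ i ht).symm) fun _ _ => rfl
  · exact fun i => ((I i).comp_const_add (t := Set.Icc 0 (l - d)) d fun x hx =>
      ⟨by linarith [hx.1], by linarith [hx.2]⟩).congr
      (fun t ht => (S.onEdge_comp_outer hd ψ i ht).symm) fun _ _ => rfl
  · intro i
    simp [gl]
  · simp
  · exact L

theorem map_pullback : ((S.gluedGraph hd).eigenspace r ⊓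
      (S.symmetric (hd.1.trans hd.2)).comap (S.pullback hd)).map (S.pullback hd) =
    (S.leafGraph (hd.1.trans hd.2)).eigenspace r ⊓ S.symmetric (hd.1.trans hd.2) := by
  ext ψ
  constructor
  · rintro ⟨φ, ⟨h, hs⟩, rfl⟩
    exact ⟨S.pullback_mem_eigenspace hd h hs, hs⟩
  · rintro ⟨h, hs⟩
    obtain ⟨φ, rfl⟩ := S.exists_pullback_eq hd hs
    exact ⟨φ, ⟨S.mem_eigenspace_of_pullback hd h, hs⟩, rfl⟩

/-- Coordinates for the antisymmetric parts of an eigenfunction of the glued graph: the part on the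
inner edges vanishes at both of their ends and is determined by the difference of the derivatives at
the root, and the part on the outer edges satisfies a Neumann condition at the tips and is
determined by the difference of the values there. -/
noncomputable def oddData : (S.gluedGraph hd).eigenspace r →ₗ[ℝ] ℝ × ℝ :=
  ((S.gluedGraph hd).startDeriv r (.inr (.inl true)) -
    (S.gluedGraph hd).startDeriv r (.inr (.inl false))).prod
  (evalSub _
    ((S.gluedGraph hd).point (.inr (.inr true)) ⟨l - d, sub_nonneg.2 hd.2.le, le_rfl⟩)
    ((S.gluedGraph hd).point (.inr (.inr false)) ⟨l - d, sub_nonneg.2 hd.2.le, le_rfl⟩))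

theorem oddData_eq {ψ : (S.gluedGraph hd).Space → ℝ} (h : ψ ∈ (S.gluedGraph hd).eigenspace r) :
    S.oddData hd ⟨ψ, h⟩ = ((S.gluedGraph hd).startDeriv r (.inr (.inl true)) ⟨ψ, h⟩ -
        (S.gluedGraph hd).startDeriv r (.inr (.inl false)) ⟨ψ, h⟩,
      (S.gluedGraph hd).onEdge ψ (.inr (.inr true)) (l - d) -
        (S.gluedGraph hd).onEdge ψ (.inr (.inr false)) (l - d)) := by
  have hm : l - d ∈ Set.Icc 0 (l - d) := ⟨sub_nonneg.2 hd.2.le, le_rfl⟩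
  rw [onEdge_of_mem (Γ := S.gluedGraph hd) ψ (.inr (.inr true)) hm,
    onEdge_of_mem (Γ := S.gluedGraph hd) ψ (.inr (.inr false)) hm]
  rfl

theorem oddData_eq_zero_iff {ψ : (S.gluedGraph hd).Space → ℝ}
    (h : ψ ∈ (S.gluedGraph hd).eigenspace r) :
    S.oddData hd ⟨ψ, h⟩ = 0 ↔ S.pullback hd ψ ∈ S.symmetric (hd.1.trans hd.2) := by
  obtain ⟨h1, h2⟩ := id hd
  obtain ⟨⟨g, H, g0, f0, -⟩, ⟨g', H', gl', f0'⟩⟩ := S.odd_part_glued hd h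
  rw [oddData_eq, ← g0, pullback_mem_symmetric, Prod.mk_eq_zero]
  have m0 : (0 : ℝ) ∈ Set.Icc 0 d := ⟨le_rfl, h1.le⟩
  have ml : l - d ∈ Set.Icc 0 (l - d) := ⟨sub_nonneg.2 h2.le, le_rfl⟩
  constructor
  · rintro ⟨a, b⟩
    exact ⟨fun t ht => sub_eq_zero.1 (H.eq_zero m0 f0 a ht).1,
      fun t ht => sub_eq_zero.1 (H'.eq_zero ml b gl' ht).1⟩
  · rintro ⟨a, b⟩
    refine ⟨?_, sub_eq_zero.2 (b _ ml)⟩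
    exact H.deriv_unique h1 (SolOn.zero r _) (fun t ht => sub_eq_zero.2 (a t ht)) m0

/-- Every antisymmetric mode of the inner and outer edges that the length data allow occurs, and it
vanishes at the root. -/
theorem exists_oddData_eq {p : ℝ × ℝ}
    (hp : p ∈ (lineIf (HasDirichletMode r d)).prod (lineIf (HasDirichletNeumannMode r (l - d)))) :
    ∃ ψ, ∃ h : ψ ∈ (S.gluedGraph hd).eigenspace r, S.oddData hd ⟨ψ, h⟩ = p ∧
      (S.gluedGraph hd).onEdge ψ (.inr (.inl true)) 0 = 0 := by
  obtain ⟨a, b⟩ := p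
  obtain ⟨ha, hb⟩ := hp
  replace ha := mem_lineIf.1 ha
  replace hb := mem_lineIf.1 hb
  have A : ∃ f g, SolOn r (Set.Icc 0 d) f g ∧ f 0 = 0 ∧ f d = 0 ∧ 2 * g 0 = a := by
    by_cases a0 : a = 0
    · exact ⟨_, _, SolOn.zero r _, rfl, rfl, by simp [a0]⟩
    · obtain ⟨f, g, H, f0, fd, g0⟩ := ha a0
      exact ⟨_, _, H.smul (a / (2 * g 0)), by simp [f0], by simp [fd], by field_simp⟩
  have B : ∃ f g, SolOn r (Set.Icc 0 (l - d)) f g ∧ f 0 = 0 ∧ g (l - d) = 0 ∧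
      2 * f (l - d) = b := by
    by_cases b0 : b = 0
    · exact ⟨_, _, SolOn.zero r _, rfl, rfl, by simp [b0]⟩
    · obtain ⟨f, g, H, f0, gl, fl⟩ := hb b0
      exact ⟨_, _, H.smul (b / (2 * f (l - d))), by simp [f0], by simp [gl], by field_simp⟩
  obtain ⟨f, g, H, f0, fd, rfl⟩ := A
  obtain ⟨f', g', H', f0', gl', rfl⟩ := B
  obtain ⟨ψ, h, e1, e2, e3⟩ := S.exists_odd_glued hd H f0 fd H' f0' gl'
  exact ⟨ψ, h, by rw [oddData_eq, e1, e2], e3⟩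

theorem range_oddData : LinearMap.range (S.oddData (r := r) hd) =
    (lineIf (HasDirichletMode r d)).prod (lineIf (HasDirichletNeumannMode r (l - d))) := by
  ext p
  constructor
  · rintro ⟨⟨ψ, h⟩, rfl⟩
    obtain ⟨⟨g, H, g0, f0, fd⟩, ⟨g', H', gl', f0'⟩⟩ := S.odd_part_glued hd h
    rw [oddData_eq, ← g0]
    exact ⟨mem_lineIf.2 fun hx => ⟨_, g, H, f0, fd, hx⟩,
      mem_lineIf.2 fun hx => ⟨_, g', H', f0', gl', hx⟩⟩
  · intro hp
    obtain ⟨ψ, h, e, -⟩ := S.exists_oddData_eq hd hp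
    exact ⟨⟨ψ, h⟩, e⟩

theorem finrank_glued : (S.gluedGraph hd).spec r =
    Module.finrank ℝ ((S.leafGraph (hd.1.trans hd.2)).eigenspace r ⊓
      S.symmetric (hd.1.trans hd.2) : Submodule ℝ _) +
      Module.finrank ℝ ((lineIf (HasDirichletMode r d)).prod
        (lineIf (HasDirichletNeumannMode r (l - d)))) := by
  rw [← range_oddData S hd, ← map_pullback S hd,
    ((S.gluedGraph hd).eigenspace r ⊓
      (S.symmetric (hd.1.trans hd.2)).comap (S.pullback hd)).equivMapOfInjective _
        (S.pullback_injective hd) |>.finrank_eq.symm]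
  refine Submodule.finrank_eq_range_add _ inf_le_left fun ψ h => ?_
  rw [oddData_eq_zero_iff, Submodule.mem_inf, and_iff_right h, Submodule.mem_comap]

end eigen

end LeafSite

end MetricGraph

/-! ### Connected components of a space with two points identified -/

open Classical in
/-- Identifying two points `a` and `b` of a locally connected space reduces the number of connected
components by one if they lie in different components, and does not change it otherwise. -/
theorem ENat.card_connectedComponents_of_glue {X Y : Type*} [TopologicalSpace X]
    [TopologicalSpace Y] [LocallyConnectedSpace X] {q : X → Y} (hq : Topology.IsQuotientMap q)
    {a b : X} (hab : q a = q b)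
    (h : ∀ x x', q x = q x' → x = x' ∨ (x = a ∨ x = b) ∧ (x' = a ∨ x' = b)) :
    ENat.card (ConnectedComponents X) = ENat.card (ConnectedComponents Y) +
      if (a : ConnectedComponents X) = b then 0 else 1 := by
  let m : ConnectedComponents X → ConnectedComponents Y := hq.continuous.connectedComponentsMap
  have hm : ∀ x : X, m x = (q x : ConnectedComponents Y) := fun x => rfl
  have hsurj : Function.Surjective m := by
    intro c
    obtain ⟨y, rfl⟩ := ConnectedComponents.surjective_coe c
    obtain ⟨x, rfl⟩ := hq.surjective y
    exact ⟨x, rfl⟩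
  -- Collapsing the component of `b` to that of `a` is locally constant and factors through `q`.
  let col : ConnectedComponents X → ConnectedComponents X := fun c => if c = b then a else c
  have hcol : Continuous fun x : X => col x :=
    (continuous_of_discreteTopology (f := col)).comp ConnectedComponents.continuous_coe
  have hcolq : ∀ x x', q x = q x' → col x = col x' := by
    have hcb : col b = a := if_pos rfl
    have hca : col a = a := by simp [col]
    intro x x' hxx
    rcases h x x' hxx with rfl | ⟨rfl | rfl, rfl | rfl⟩ <;> simp [hca, hcb]
  have hk : Continuous (fun y => col (Function.surjInv hq.surjective y : X)) := by
    rw [hq.continuous_iff]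
    refine hcol.congr fun x => hcolq _ _ ?_
    exact (Function.surjInv_eq hq.surjective (q x)).symm
  have hinj : ∀ c c', m c = m c' → col c = col c' := by
    have key : ∀ c, hk.connectedComponentsLift (m c) = col c := by
      intro c
      obtain ⟨x, rfl⟩ := ConnectedComponents.surjective_coe c
      exact hcolq _ _ (Function.surjInv_eq hq.surjective (q x))
    intro c c' hc
    rw [← key, ← key, hc]
  split_ifs with he
  · rw [add_zero]
    have : ∀ c, col c = c := fun c => by
      simp only [col]
      split_ifs with hc
      · exact he.trans hc.symm
      · rfl
    refine ENat.card_congr (Equiv.ofBijective m ⟨fun c c' hc => ?_, hsurj⟩)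
    rw [← this c, ← this c', hinj c c' hc]
  · have hbij : Function.Bijective
        fun c : {c : ConnectedComponents X // c ≠ (b : ConnectedComponents X)} => m c := by
      refine ⟨fun c c' hc => ?_, fun c => ?_⟩
      · have := hinj _ _ hc
        simp only [col, if_neg c.2, if_neg c'.2] at this
        exact Subtype.ext this
      · obtain ⟨c, rfl⟩ := hsurj c
        by_cases hc : c = (b : ConnectedComponents X)
        · refine ⟨⟨a, he⟩, ?_⟩
          change m a = m c
          rw [hc, hm, hm, hab]
        · exact ⟨⟨c, hc⟩, rfl⟩
    rw [← ENat.card_congr (Equiv.ofBijective _ hbij),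
      ← ENat.card_congr (Equiv.optionSubtypeNe (b : ConnectedComponents X)),
      ENat.card_congr (Equiv.optionEquivSumPUnit.{0} _), ENat.card_sum]
    simp

/-! ### The profile of an eigenfunction on a leaf -/

/-- Some solution of `-f'' = r f` on `[0, l]` with a Neumann condition at `l`, which does not vanish
at the root `0`, has a zero in `[0, d]`. -/
def LeafProfileVanishes (r l d : ℝ) : Prop :=
  ∃ f g, SolOn r (Set.Icc 0 l) f g ∧ g l = 0 ∧ f 0 ≠ 0 ∧ ∃ t ∈ Set.Icc 0 d, f t = 0

/-- The Neumann condition at `l` determines the solution up to a factor. -/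
theorem SolOn.proportional {r l : ℝ} {f g f' g' : ℝ → ℝ} (hl : 0 ≤ l)
    (H : SolOn r (Set.Icc 0 l) f g) (gl : g l = 0) (H' : SolOn r (Set.Icc 0 l) f' g')
    (gl' : g' l = 0) {x : ℝ} (hx : x ∈ Set.Icc 0 l) : f' l * f x = f l * f' x :=
  sub_eq_zero.1 (((H.smul (f' l)).sub (H'.smul (f l))).eq_zero (⟨hl, le_rfl⟩ : l ∈ Set.Icc 0 l)
    (by ring) (by simp [gl, gl']) hx).1

/-- By proportionality, a single solution that
does not vanish at `0` decides whether `LeafProfileVanishes` holds. -/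
theorem SolOn.leafProfileVanishes_iff {r l d : ℝ} {f g : ℝ → ℝ} (hd : d ∈ Set.Ioo 0 l)
    (H : SolOn r (Set.Icc 0 l) f g) (gl : g l = 0) (f0 : f 0 ≠ 0) :
    LeafProfileVanishes r l d ↔ ∃ t ∈ Set.Icc 0 d, f t = 0 := by
  have hl : 0 ≤ l := (hd.1.trans hd.2).le
  have ml : l ∈ Set.Icc 0 l := ⟨hl, le_rfl⟩
  have m0 : (0 : ℝ) ∈ Set.Icc 0 l := ⟨le_rfl, hl⟩
  constructor
  · rintro ⟨f', g', H', gl', f0', t, ht, hft⟩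
    refine ⟨t, ht, ?_⟩
    have fl : f' l ≠ 0 := fun h => f0' (H'.eq_zero ml h gl' m0).1
    have := H.proportional hl gl H' gl' ⟨ht.1, ht.2.trans hd.2.le⟩
    simpa [hft, fl] using this
  · exact fun ⟨t, ht, hft⟩ => ⟨f, g, H, gl, f0, t, ht, hft⟩

theorem SolOn.not_hasDirichletNeumannMode {r l : ℝ} {f g : ℝ → ℝ} (hl : 0 ≤ l)
    (H : SolOn r (Set.Icc 0 l) f g) (gl : g l = 0) (f0 : f 0 ≠ 0) :
    ¬HasDirichletNeumannMode r l := by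
  rintro ⟨f', g', H', f0', gl', fl'⟩
  have := H.proportional hl gl H' gl' (⟨le_rfl, hl⟩ : (0 : ℝ) ∈ Set.Icc 0 l)
  simp [f0', f0, fl'] at this

namespace MetricGraph

/-! ### Local connectedness -/

instance {V E : Type*} (Γ : MetricGraph V E) : LocallyPathConnectedSpace Γ.Space := by
  have : ∀ e, LocallyPathConnectedSpace (Set.Icc (0 : ℝ) (Γ.len e)) := fun e =>
    (convex_Icc (0 : ℝ) (Γ.len e)).locallyPathConnectedSpace
  exact inferInstanceAs (LocallyPathConnectedSpace (Quot _))

namespace LeafSite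

variable {V E : Type*} {G : MetricGraph V E} (S : G.LeafSite) {d l r : ℝ}
  (hd : d ∈ Set.Ioo 0 l)

/-! ### Generic eigenfunctions of the glued graph -/

section generic

variable {ψ : (S.gluedGraph hd).Space → ℝ}

/-- The glue points lie in the same nodal domain if the profile has no zero between the root and
the glue point. -/
theorem mk_gluePoint_eq
    (h : ∀ i, ∀ t ∈ Set.Icc 0 d,
      (S.leafGraph (hd.1.trans hd.2)).onEdge (ψ ∘ S.glueMap hd) (.inr i) t ≠ 0)
    (ht : (ψ ∘ S.glueMap hd) (S.gluePoint hd true) ≠ 0)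
    (hf : (ψ ∘ S.glueMap hd) (S.gluePoint hd false) ≠ 0) :
    ConnectedComponents.mk (⟨S.gluePoint hd true, ht⟩ : {x // (ψ ∘ S.glueMap hd) x ≠ 0}) =
      ConnectedComponents.mk ⟨S.gluePoint hd false, hf⟩ := by
  let Γ := S.leafGraph (hd.1.trans hd.2)
  have hle : ∀ t : Set.Icc 0 d, (t : ℝ) ∈ Set.Icc 0 l := fun t => ⟨t.2.1, t.2.2.trans hd.2.le⟩
  let γ : Bool → Set.Icc 0 d → {x // (ψ ∘ S.glueMap hd) x ≠ 0} := fun i t =>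
    ⟨Γ.point (.inr i) ⟨t, hle t⟩, fun h0 => h i t t.2
      ((onEdge_of_mem (Γ := Γ) (ψ ∘ S.glueMap hd) (.inr i) (hle t)).trans h0)⟩
  have hγ : ∀ i, Continuous (γ i) := fun i => Continuous.subtype_mk
    (continuous_quot_mk.comp ((continuous_sigmaMk
      (σ := fun e => Set.Icc (0 : ℝ) (Γ.len e)) (i := .inr i)).comp
        (Continuous.subtype_mk continuous_subtype_val _))) _
  have : PreconnectedSpace (Set.Icc 0 d) :=
    isPreconnected_iff_preconnectedSpace.1 isPreconnected_Icc
  have hconst : ∀ i s t, ConnectedComponents.mk (γ i s) = ConnectedComponents.mk (γ i t) :=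
    fun i s t =>
    congrArg (hγ i).connectedComponentsMap
      (Subsingleton.elim (s : ConnectedComponents (Set.Icc 0 d)) t)
  have h0 : γ true ⟨0, le_rfl, hd.1.le⟩ = γ false ⟨0, le_rfl, hd.1.le⟩ :=
    Subtype.ext (Quot.sound ⟨S.root, Or.inl ⟨rfl, rfl⟩, Or.inl ⟨rfl, rfl⟩⟩)
  exact (hconst true ⟨d, hd.1.le, le_rfl⟩ ⟨0, le_rfl, hd.1.le⟩).trans
    ((congrArg _ h0).trans (hconst false _ ⟨d, hd.1.le, le_rfl⟩))

/-- The glue points lie in different nodal domains if a zero separates them. -/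
theorem mk_gluePoint_ne {t₀ : ℝ} (h0 : 0 < t₀) (hd0 : t₀ < d)
    (h : (S.leafGraph (hd.1.trans hd.2)).onEdge (ψ ∘ S.glueMap hd) (.inr true) t₀ = 0)
    (ht : (ψ ∘ S.glueMap hd) (S.gluePoint hd true) ≠ 0)
    (hf : (ψ ∘ S.glueMap hd) (S.gluePoint hd false) ≠ 0) :
    ConnectedComponents.mk (⟨S.gluePoint hd true, ht⟩ : {x // (ψ ∘ S.glueMap hd) x ≠ 0}) ≠
      ConnectedComponents.mk ⟨S.gluePoint hd false, hf⟩ := by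
  classical
  let Γ := S.leafGraph (hd.1.trans hd.2)
  -- The distance from the root along one leaf, extended by zero, is continuous and avoids the
  -- value `t₀` off the zeros, so it separates the glue points.
  let F : E ⊕ Bool → ℝ → ℝ := Sum.elim (fun _ _ => 0) fun i t => if i then t else 0
  let u : V → ℝ := fun v => if v = S.tip true then l else 0
  let D : Γ.Space → ℝ := Γ.ofEdges F u
    (by
      rintro (e | i)
      · exact (if_neg (S.src_ne_tip e true)).symm
      · refine Eq.trans ?_ (if_neg (S.tip_ne_root true).symm).symm
        cases i <;> simp [F])
    (by
      rintro (e | i)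
      · exact (if_neg (S.tgt_ne_tip e true)).symm
      · change (if i then l else 0) = if S.tip i = S.tip true then l else 0
        cases i <;> simp [S.tip_injective.eq_iff])
  have hD : Continuous D := by
    refine (isQuotientMap_quot_mk (r := fun x y : Γ.EdgePoint =>
      ∃ v, Γ.AtVertex x v ∧ Γ.AtVertex y v)).continuous_iff.2 (continuous_sigma ?_)
    rintro (e | _ | _)
    · exact continuous_const
    · exact continuous_const
    · exact continuous_subtype_val
  have hne : ∀ x : {x // (ψ ∘ S.glueMap hd) x ≠ 0}, D x ≠ t₀ := by
    rintro ⟨x, hx⟩ hxt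
    obtain ⟨e | i, t, rfl⟩ := exists_point x
    · exact h0.ne hxt
    · cases i
      · exact h0.ne hxt
      · have htt : (t : ℝ) = t₀ := hxt
        exact hx ((onEdge_coe (Γ := Γ) (ψ ∘ S.glueMap hd) (.inr true) t).symm.trans
          ((congrArg (Γ.onEdge (ψ ∘ S.glueMap hd) (.inr true)) htt).trans h))
  have hclopen : IsClopen {x : {x // (ψ ∘ S.glueMap hd) x ≠ 0} | t₀ < D x} := by
    refine ⟨?_, isOpen_lt continuous_const (hD.comp continuous_subtype_val)⟩
    convert isClosed_le (continuous_const (y := t₀)) (hD.comp continuous_subtype_val) using 1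
    ext x
    exact ⟨fun h : t₀ < D x => h.le, fun h : t₀ ≤ D x => h.lt_of_ne (hne x).symm⟩
  intro heq
  have hmem : t₀ < D (S.gluePoint hd false) := hclopen.connectedComponent_subset
    (show t₀ < D (S.gluePoint hd true) from hd0) (ConnectedComponents.coe_eq_coe'.1 heq.symm)
  exact h0.not_gt hmem

variable [Fintype E]

theorem root_ne_zero (hg : (S.gluedGraph hd).IsGeneric ψ) (i : Bool) :
    (S.gluedGraph hd).onEdge ψ (.inr (.inl i)) 0 ≠ 0 := by
  rw [onEdge_of_mem (Γ := S.gluedGraph hd) ψ (.inr (.inl i)) ⟨le_rfl, hd.1.le⟩]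
  exact hg.2 ⟨.inr (.inl i), 0, le_rfl, hd.1.le⟩ (some S.root) (Or.inl ⟨rfl, rfl⟩)

theorem glue_ne_zero (hg : (S.gluedGraph hd).IsGeneric ψ) (i : Bool) :
    (S.gluedGraph hd).onEdge ψ (.inr (.inl i)) d ≠ 0 := by
  rw [onEdge_of_mem (Γ := S.gluedGraph hd) ψ (.inr (.inl i)) ⟨hd.1.le, le_rfl⟩]
  exact hg.2 ⟨.inr (.inl i), d, hd.1.le, le_rfl⟩ none (Or.inr ⟨rfl, rfl⟩)

/-- Generic eigenfunctions are symmetric: an antisymmetric part would span the simple eigenspace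
and vanish at the root. -/
theorem pullback_symmetric (hg : (S.gluedGraph hd).IsGeneric ψ)
    (he : (S.gluedGraph hd).IsEigenfunction r ψ) :
    S.pullback hd ψ ∈ S.symmetric (hd.1.trans hd.2) := by
  rw [← S.oddData_eq_zero_iff hd he.1]
  have hp : S.oddData hd ⟨ψ, he.1⟩ ∈ LinearMap.range (S.oddData (r := r) hd) := ⟨_, rfl⟩
  rw [range_oddData] at hp
  obtain ⟨φ, hφ, e, h0⟩ := S.exists_oddData_eq hd hp
  have hne : (⟨ψ, he.1⟩ : (S.gluedGraph hd).eigenspace r) ≠ 0 := fun h =>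
    he.2 (congrArg Subtype.val h)
  obtain ⟨c, hc⟩ := (finrank_eq_one_iff_of_nonzero' _ hne).1 (hg.spec_eq_one he) ⟨φ, hφ⟩
  have hc' : c * (S.gluedGraph hd).onEdge ψ (.inr (.inl true)) 0 = 0 := by
    obtain rfl : c • ψ = φ := congrArg Subtype.val hc
    exact h0
  rw [← e, ← hc, (mul_eq_zero.1 hc').resolve_right (S.root_ne_zero hd hg true), zero_smul,
    map_zero]

theorem pullback_ne_zero_of_atVertex (hg : (S.gluedGraph hd).IsGeneric ψ)
    (x : (S.leafGraph (hd.1.trans hd.2)).EdgePoint) (v : V)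
    (h : (S.leafGraph (hd.1.trans hd.2)).AtVertex x v) :
    S.pullback hd ψ ((S.leafGraph (hd.1.trans hd.2)).point x.1 x.2) ≠ 0 := by
  obtain ⟨y, rfl⟩ := S.unglue_surjective hd x
  have e : S.glueMap hd ((S.leafGraph (hd.1.trans hd.2)).point (S.unglue hd y).1
      (S.unglue hd y).2) = (S.gluedGraph hd).point y.1 y.2 := S.glueMap_unglue hd y
  change ψ (S.glueMap hd _) ≠ 0
  rw [e]
  exact hg.2 y (some v) (S.atVertex_of_unglue hd h)

/-- The profile of the pulled-back eigenfunction on a leaf. -/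
theorem exists_leafProfile (hg : (S.gluedGraph hd).IsGeneric ψ)
    (he : (S.gluedGraph hd).IsEigenfunction r ψ) (i : Bool) :
    ∃ g, SolOn r (Set.Icc 0 l)
        ((S.leafGraph (hd.1.trans hd.2)).onEdge (ψ ∘ S.glueMap hd) (.inr i)) g ∧ g l = 0 ∧
      (S.leafGraph (hd.1.trans hd.2)).onEdge (ψ ∘ S.glueMap hd) (.inr i) 0 ≠ 0 := by
  obtain ⟨g, -, H, gl, -⟩ := S.mem_leaf_eigenspace.1
    (S.pullback_mem_eigenspace hd he.1 (S.pullback_symmetric hd hg he))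
  refine ⟨_, H i, gl i, ?_⟩
  rw [S.onEdge_comp_inner hd ψ i ⟨le_rfl, hd.1.le⟩]
  exact S.root_ne_zero hd hg i

theorem pullback_isEigenfunction (hg : (S.gluedGraph hd).IsGeneric ψ)
    (he : (S.gluedGraph hd).IsEigenfunction r ψ) :
    (S.leafGraph (hd.1.trans hd.2)).IsEigenfunction r (S.pullback hd ψ) :=
  ⟨S.pullback_mem_eigenspace hd he.1 (S.pullback_symmetric hd hg he), fun h =>
    he.2 (S.pullback_injective hd (h.trans (map_zero _).symm))⟩

theorem pullback_isGeneric (hg : (S.gluedGraph hd).IsGeneric ψ)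
    (he : (S.gluedGraph hd).IsEigenfunction r ψ) :
    (S.leafGraph (hd.1.trans hd.2)).IsGeneric (S.pullback hd ψ) := by
  have he' := S.pullback_isEigenfunction hd hg he
  refine ⟨⟨r, he', ?_⟩, S.pullback_ne_zero_of_atVertex hd hg⟩
  obtain ⟨g, H, gl, f0⟩ := S.exists_leafProfile hd hg he true
  have h1 := hg.spec_eq_one he
  rw [finrank_glued] at h1
  rw [finrank_leaf, finrank_lineIf_of_not
    (H.not_hasDirichletNeumannMode (hd.1.trans hd.2).le gl f0)]
  have : FiniteDimensional ℝ ((S.leafGraph (hd.1.trans hd.2)).eigenspace r ⊓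
      S.symmetric (hd.1.trans hd.2) : Submodule ℝ _) :=
    Submodule.finiteDimensional_inf_left _ _
  have h2 : Module.finrank ℝ ((S.leafGraph (hd.1.trans hd.2)).eigenspace r ⊓
      S.symmetric (hd.1.trans hd.2) : Submodule ℝ _) ≠ 0 := by
    rw [Submodule.finrank_eq_zero.ne]
    exact fun h => he'.2 ((Submodule.eq_bot_iff _).1 h _
      ⟨he'.1, S.pullback_symmetric hd hg he⟩)
  omega

theorem flipCount_pullback (hg : (S.gluedGraph hd).IsGeneric ψ) :
    (S.leafGraph (hd.1.trans hd.2)).flipCount (S.pullback hd ψ) =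
      (S.gluedGraph hd).flipCount ψ := by
  obtain ⟨h1, h2⟩ := id hd
  simp only [flipCount, encard_zeros, Fintype.sum_sum_type, ← Finset.sum_add_distrib]
  congr 1
  · refine Finset.sum_congr rfl fun e _ => congrArg Set.encard (Set.ext fun x => ?_)
    exact and_congr_right fun hx => by rw [← S.onEdge_comp_core hd ψ e hx]; rfl
  · refine Finset.sum_congr rfl fun i _ => ?_
    rw [← Function.Injective.encard_image (add_right_injective d)
      {x : ℝ | x ∈ Set.Icc 0 ((S.gluedGraph hd).len (.inr (.inr i))) ∧ _}, ← Set.encard_union_eq]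
    · congr 1
      ext x
      constructor
      · rintro ⟨⟨hx0, hx1⟩, hx⟩
        rcases le_total x d with hxd | hxd
        · exact Or.inl ⟨⟨hx0, hxd⟩, (S.onEdge_comp_inner hd ψ i ⟨hx0, hxd⟩).symm.trans hx⟩
        · have hm : x - d ∈ Set.Icc 0 (l - d) := ⟨sub_nonneg.2 hxd, sub_le_sub_right hx1 d⟩
          refine Or.inr ⟨x - d, ⟨hm, ?_⟩, add_sub_cancel d x⟩
          rw [← S.onEdge_comp_outer hd ψ i hm, add_sub_cancel]
          exact hx
      · rintro (⟨⟨hx0, hx1⟩, hx⟩ | ⟨y, ⟨⟨hy0, hy1⟩, hy⟩, rfl⟩)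
        · exact ⟨⟨hx0, hx1.trans h2.le⟩, (S.onEdge_comp_inner hd ψ i ⟨hx0, hx1⟩).trans hx⟩
        · have hy1' : y ≤ l - d := hy1
          refine ⟨⟨add_nonneg h1.le hy0, ?_⟩, (S.onEdge_comp_outer hd ψ i ⟨hy0, hy1⟩).trans hy⟩
          change d + y ≤ l
          linarith
    -- The two parts of the leaf share only the glued point, which is no zero.
    · rw [Set.disjoint_left]
      rintro x ⟨⟨hx0, hx1⟩, hx⟩ ⟨y, ⟨⟨hy0, hy1⟩, hy⟩, rfl⟩
      have hx1' : d + y ≤ d := hx1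
      obtain rfl : y = 0 := by linarith
      simp only [add_zero] at hx
      exact S.glue_ne_zero hd hg i hx

open Classical in
theorem nodalCount_pullback (hg : (S.gluedGraph hd).IsGeneric ψ)
    (he : (S.gluedGraph hd).IsEigenfunction r ψ) :
    (S.leafGraph (hd.1.trans hd.2)).nodalCount (S.pullback hd ψ) =
      (S.gluedGraph hd).nodalCount ψ + if LeafProfileVanishes r l d then 1 else 0 := by
  have hψ := continuous_of_mem_eigenspace he.1
  have hq := S.isQuotientMap_glueMap hd
  have hopen : IsOpen {y | ψ y ≠ 0} := hψ.isOpen_preimage _ isOpen_ne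
  have hopen' : IsOpen {x | (ψ ∘ S.glueMap hd) x ≠ 0} :=
    (hψ.comp hq.continuous).isOpen_preimage _ isOpen_ne
  have hlpc := hopen'.locallyPathConnectedSpace
  have : LocallyConnectedSpace (S.glueMap hd ⁻¹' {y | ψ y ≠ 0}) :=
    inferInstanceAs (LocallyConnectedSpace {x | (ψ ∘ S.glueMap hd) x ≠ 0})
  have hne : ∀ i, (ψ ∘ S.glueMap hd) (S.gluePoint hd i) ≠ 0 := by
    intro i
    have h := S.glue_ne_zero hd hg i
    rwa [← S.onEdge_comp_inner hd ψ i ⟨hd.1.le, le_rfl⟩,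
      onEdge_of_mem (Γ := S.leafGraph (hd.1.trans hd.2)) _ (.inr i) ⟨hd.1.le, hd.2.le⟩] at h
  refine (ENat.card_connectedComponents_of_glue (hq.restrictPreimage_isOpen hopen)
    (a := ⟨S.gluePoint hd true, hne true⟩) (b := ⟨S.gluePoint hd false, hne false⟩)
    (Subtype.ext (S.glueMap_gluePoint hd true false)) ?_).trans ?_
  · rintro ⟨x, hx⟩ ⟨x', hx'⟩ hxx
    rcases S.eq_of_glueMap_eq hd (congrArg Subtype.val hxx) with rfl | ⟨⟨i, rfl⟩, ⟨j, rfl⟩⟩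
    · exact Or.inl rfl
    · refine Or.inr ⟨?_, ?_⟩
      · cases i
        · exact Or.inr rfl
        · exact Or.inl rfl
      · cases j
        · exact Or.inr rfl
        · exact Or.inl rfl
  · congr 1
    by_cases hv : LeafProfileVanishes r l d
    · obtain ⟨g, H, gl, f0⟩ := S.exists_leafProfile hd hg he true
      obtain ⟨t, ht, hft⟩ := (H.leafProfileVanishes_iff hd gl f0).1 hv
      have ht0 : 0 < t := lt_of_le_of_ne ht.1 fun h => f0 (h ▸ hft)
      have htd : t < d := lt_of_le_of_ne ht.2 fun h => by
        refine S.glue_ne_zero hd hg true ?_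
        exact (S.onEdge_comp_inner hd ψ true ⟨hd.1.le, le_rfl⟩).symm.trans
          ((congrArg _ h.symm).trans hft)
      rw [if_pos hv]
      exact if_neg (S.mk_gluePoint_ne hd ht0 htd hft (hne true) (hne false))
    · rw [if_neg hv]
      refine if_pos (S.mk_gluePoint_eq hd ?_ (hne true) (hne false))
      intro i t ht h
      obtain ⟨g, H, gl, f0⟩ := S.exists_leafProfile hd hg he i
      exact hv ((H.leafProfileVanishes_iff hd gl f0).2 ⟨t, ht, h⟩)

end generic

end LeafSite

end MetricGraph

namespace MetricGraph

variable {V E : Type*} {Γ : MetricGraph V E} {l d : ℝ}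

/-! ### Leaf pairs in normal form -/

/-- A vertex of degree one is an end of only one edge, and only one end of it. -/
theorem eq_of_degree_eq_one {v : V} (h : Γ.degree v = 1) {e e' : E}
    (he : Γ.src e = v ∨ Γ.tgt e = v) (he' : Γ.src e' = v ∨ Γ.tgt e' = v) :
    e = e' ∧ ¬(Γ.src e = v ∧ Γ.tgt e = v) := by
  have h1 : {e | Γ.src e = v}.encard ≤ 1 := h ▸ le_self_add
  have h2 : {e | Γ.tgt e = v}.encard ≤ 1 := h ▸ le_add_self
  have h3 : ∀ {a b}, Γ.src a = v → Γ.tgt b = v → False := by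
    intro a b ha hb
    have ha' : 1 ≤ {e | Γ.src e = v}.encard := Set.one_le_encard_iff_nonempty.2 ⟨a, ha⟩
    have hb' : 1 ≤ {e | Γ.tgt e = v}.encard := Set.one_le_encard_iff_nonempty.2 ⟨b, hb⟩
    -- Ends of both kinds at `v`, on one edge or on two, would make the degree at least two.
    have := add_le_add ha' hb'
    rw [← degree, h] at this
    exact absurd this (by decide)
  refine ⟨?_, fun h => h3 h.1 h.2⟩
  rcases he with he | he <;> rcases he' with he' | he'
  · exact Set.encard_le_one_iff.1 h1 _ _ he he'
  · exact (h3 he he').elim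
  · exact (h3 he' he).elim
  · exact Set.encard_le_one_iff.1 h2 _ _ he he'

namespace LeafPair

variable (P : Γ.LeafPair l)

theorem incident (i : Bool) :
    Γ.src (P.edge i) = P.tip i ∨ Γ.tgt (P.edge i) = P.tip i := by
  rcases P.joins i with h | h
  · exact Or.inr h.2
  · exact Or.inl h.1

theorem tip_ne_root (i : Bool) : P.tip i ≠ P.root := by
  intro h
  have := (eq_of_degree_eq_one (P.degree_tip i) (P.incident i) (P.incident i)).2
  rcases P.joins i with h' | h'
  · exact this ⟨h'.1.trans h.symm, h'.2⟩
  · exact this ⟨h'.1, h'.2.trans h.symm⟩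

theorem eq_edge {e : E} {i : Bool} (h : Γ.src e = P.tip i ∨ Γ.tgt e = P.tip i) : e = P.edge i :=
  (eq_of_degree_eq_one (P.degree_tip i) h (P.incident i)).1

/-- The graph without the two leaves. -/
def core : MetricGraph V {e // e ∉ Set.range P.edge} where
  src e := Γ.src e
  tgt e := Γ.tgt e
  len e := Γ.len e
  len_pos e := Γ.len_pos e

/-- The root and the tips of the leaf pair, as vertices of the graph without the two leaves. -/
def site : P.core.LeafSite where
  root := P.root
  tip := P.tip
  tip_injective i _ h := P.edge_injective (P.eq_edge (h ▸ P.incident i))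
  tip_ne_root := P.tip_ne_root
  src_ne_tip e i h := e.2 ⟨i, (P.eq_edge (Or.inl h)).symm⟩
  tgt_ne_tip e i h := e.2 ⟨i, (P.eq_edge (Or.inr h)).symm⟩

open Classical in
/-- The leaf `i` is oriented towards the root. -/
noncomputable def reversed (i : Bool) : Bool := decide (Γ.src (P.edge i) ≠ P.root)

theorem of_reversed {i : Bool} (h : P.reversed i = true) :
    Γ.src (P.edge i) = P.tip i ∧ Γ.tgt (P.edge i) = P.root ∧ P.pos d i = l - d := by
  have h' : Γ.src (P.edge i) ≠ P.root := by simpa [reversed] using h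
  have h2 := (P.joins i).resolve_left fun h => h' h.1
  exact ⟨h2.1, h2.2, if_neg h'⟩

theorem of_not_reversed {i : Bool} (h : P.reversed i = false) :
    Γ.src (P.edge i) = P.root ∧ Γ.tgt (P.edge i) = P.tip i ∧ P.pos d i = d := by
  have h' : Γ.src (P.edge i) = P.root := by simpa [reversed] using h
  have h2 := (P.joins i).resolve_right fun h => P.tip_ne_root i (h.1.symm.trans h')
  exact ⟨h2.1, h2.2, if_pos h'⟩

theorem bijective_edge :
    Function.Bijective (Sum.elim Subtype.val P.edge : {e // e ∉ Set.range P.edge} ⊕ Bool → E) := by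
  constructor
  · rintro (e | i) (e' | j) h
    · exact congrArg Sum.inl (Subtype.ext h)
    · exact (e.2 ⟨j, h.symm⟩).elim
    · exact (e'.2 ⟨i, h⟩).elim
    · exact congrArg Sum.inr (P.edge_injective h)
  · intro e
    by_cases h : e ∈ Set.range P.edge
    · obtain ⟨i, rfl⟩ := h
      exact ⟨.inr i, rfl⟩
    · exact ⟨.inl ⟨e, h⟩, rfl⟩

/-- A graph with a leaf pair, in normal form. -/
noncomputable def reparam (hl : 0 < l) : Reparam (P.site.leafGraph hl) Γ where
  edge := Equiv.ofBijective _ P.bijective_edge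
  flip := Sum.elim (fun _ => false) P.reversed
  len_edge
    | .inl _ => rfl
    | .inr i => P.len_edge i
  src_edge
    | .inl _ => rfl
    | .inr i => by
      change Γ.src (P.edge i) = if P.reversed i = true then P.tip i else P.root
      split_ifs with h
      · exact (P.of_reversed (d := 0) h).1
      · exact (P.of_not_reversed (d := 0) (Bool.eq_false_of_not_eq_true h)).1
  tgt_edge
    | .inl _ => rfl
    | .inr i => by
      change Γ.tgt (P.edge i) = if P.reversed i = true then P.root else P.tip i
      split_ifs with h
      · exact (P.of_reversed (d := 0) h).2.1
      · exact (P.of_not_reversed (d := 0) (Bool.eq_false_of_not_eq_true h)).2.1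

/-- The correspondence between the edges of the normal form of the glued graph and those of the
glued graph. The two parts of a leaf are exchanged if the leaf is oriented towards the root. -/
noncomputable def gluedEdge : {e // e ∉ Set.range P.edge} ⊕ (Bool ⊕ Bool) → E ⊕ Bool
  | .inl e => .inl e
  | .inr (.inl i) => bif P.reversed i then .inr i else .inl (P.edge i)
  | .inr (.inr i) => bif P.reversed i then .inl (P.edge i) else .inr i

theorem bijective_gluedEdge : Function.Bijective P.gluedEdge := by
  have hr : ∀ (e : {e // e ∉ Set.range P.edge}) i, (e : E) ≠ P.edge i :=
    fun e i h => e.2 ⟨i, h.symm⟩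
  have hr' : ∀ (e : {e // e ∉ Set.range P.edge}) i, P.edge i ≠ e := fun e i h => e.2 ⟨i, h⟩
  constructor
  · rintro (e | i | i) (e' | j | j) h
    · exact congrArg Sum.inl (Subtype.ext (Sum.inl_injective h))
    · cases hj : P.reversed j <;> simp [gluedEdge, hj, hr] at h
    · cases hj : P.reversed j <;> simp [gluedEdge, hj, hr] at h
    · cases hi : P.reversed i <;> simp [gluedEdge, hi, hr'] at h
    · cases hi : P.reversed i <;> cases hj : P.reversed j <;>
        simp [gluedEdge, hi, hj, P.edge_injective.eq_iff] at h <;> simp_all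
    · cases hi : P.reversed i <;> cases hj : P.reversed j <;>
        simp [gluedEdge, hi, hj, P.edge_injective.eq_iff] at h <;> simp_all
    · cases hi : P.reversed i <;> simp [gluedEdge, hi, hr'] at h
    · cases hi : P.reversed i <;> cases hj : P.reversed j <;>
        simp [gluedEdge, hi, hj, P.edge_injective.eq_iff] at h <;> simp_all
    · cases hi : P.reversed i <;> cases hj : P.reversed j <;>
        simp [gluedEdge, hi, hj, P.edge_injective.eq_iff] at h <;> simp_all
  · rintro (e | i)
    · by_cases h : e ∈ Set.range P.edge
      · obtain ⟨i, rfl⟩ := h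
        cases hi : P.reversed i
        · exact ⟨.inr (.inl i), by simp [gluedEdge, hi]⟩
        · exact ⟨.inr (.inr i), by simp [gluedEdge, hi]⟩
      · exact ⟨.inl ⟨e, h⟩, rfl⟩
    · cases hi : P.reversed i
      · exact ⟨.inr (.inr i), by simp [gluedEdge, hi]⟩
      · exact ⟨.inr (.inl i), by simp [gluedEdge, hi]⟩

variable (hd : d ∈ Set.Ioo 0 l)

theorem glue_len_edge (i : Bool) : (P.glue hd).len (.inl (P.edge i)) = P.pos d i := by
  cases i <;> simp [glue, P.edge_injective.eq_iff]

theorem glue_tgt_edge (i : Bool) : (P.glue hd).tgt (.inl (P.edge i)) = none :=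
  if_pos ⟨i, rfl⟩

/-- The glued graph, in normal form. -/
noncomputable def gluedReparam : Reparam (P.site.gluedGraph hd) (P.glue hd) where
  edge := Equiv.ofBijective _ P.bijective_gluedEdge
  flip := Sum.elim (fun _ => false) (Sum.elim P.reversed P.reversed)
  len_edge
    | .inl e => (if_neg fun h => e.2 ⟨true, h.symm⟩).trans (if_neg fun h => e.2 ⟨false, h.symm⟩)
    | .inr (.inl i) => by
      change (P.glue hd).len (P.gluedEdge (.inr (.inl i))) = d
      cases hi : P.reversed i
      · simpa [gluedEdge, hi, glue_len_edge] using (P.of_not_reversed hi).2.2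
      · simp [gluedEdge, hi, glue, (P.of_reversed (d := d) hi).2.2]
    | .inr (.inr i) => by
      change (P.glue hd).len (P.gluedEdge (.inr (.inr i))) = l - d
      cases hi : P.reversed i
      · simp [gluedEdge, hi, glue, (P.of_not_reversed (d := d) hi).2.2]
      · simpa [gluedEdge, hi, glue_len_edge] using (P.of_reversed hi).2.2
  src_edge
    | .inl _ => rfl
    | .inr (.inl i) => by
      change (P.glue hd).src (P.gluedEdge (.inr (.inl i))) =
        if P.reversed i = true then none else some P.root
      cases hi : P.reversed i
      · simp [gluedEdge, hi, glue, (P.of_not_reversed (d := d) hi).1]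
      · simp [gluedEdge, hi, glue]
    | .inr (.inr i) => by
      change (P.glue hd).src (P.gluedEdge (.inr (.inr i))) =
        if P.reversed i = true then some (P.tip i) else none
      cases hi : P.reversed i
      · simp [gluedEdge, hi, glue]
      · simp [gluedEdge, hi, glue, (P.of_reversed (d := d) hi).1]
  tgt_edge
    | .inl e => if_neg e.2
    | .inr (.inl i) => by
      change (P.glue hd).tgt (P.gluedEdge (.inr (.inl i))) =
        if P.reversed i = true then some P.root else none
      cases hi : P.reversed i
      · simp [gluedEdge, hi, glue_tgt_edge]
      · simp [gluedEdge, hi, glue, (P.of_reversed (d := d) hi).2.1]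
    | .inr (.inr i) => by
      change (P.glue hd).tgt (P.gluedEdge (.inr (.inr i))) =
        if P.reversed i = true then none else some (P.tip i)
      cases hi : P.reversed i
      · simp [gluedEdge, hi, glue, (P.of_not_reversed (d := d) hi).2.1]
      · simp [gluedEdge, hi, glue_tgt_edge]

variable [Fintype E]

/-- The two spectra differ from the spectrum `s` of the symmetric eigenfunctions by multiplicities
that depend only on `l` and `d`. -/
theorem exists_spec_eq : ∃ s : ℝ → ℕ, ∀ r,
    Γ.spec r = s r + Module.finrank ℝ (lineIf (HasDirichletNeumannMode r l)) ∧
    (P.glue hd).spec r = s r + Module.finrank ℝ ((lineIf (HasDirichletMode r d)).prod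
      (lineIf (HasDirichletNeumannMode r (l - d)))) := by
  classical
  exact ⟨fun r => Module.finrank ℝ ((P.site.leafGraph (hd.1.trans hd.2)).eigenspace r ⊓
    P.site.symmetric (hd.1.trans hd.2) : Submodule ℝ _), fun r => ⟨((P.reparam (hd.1.trans hd.2)).spec_eq r).symm.trans (P.site.finrank_leaf _),
    ((P.gluedReparam hd).spec_eq r).symm.trans (P.site.finrank_glued hd)⟩⟩

open Classical in
/-- A generic eigenfunction of the glued graph comes from a generic eigenfunction of the original
graph with the same zeros; the gluing merges two nodal domains or none, depending only on the
eigenvalue and on `l` and `d`. -/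
theorem exists_generic {r : ℝ} {ψ : (P.glue hd).Space → ℝ} (hg : (P.glue hd).IsGeneric ψ)
    (he : (P.glue hd).IsEigenfunction r ψ) : ∃ φ : Γ.Space → ℝ,
      Γ.IsEigenfunction r φ ∧ Γ.IsGeneric φ ∧ Γ.flipCount φ = (P.glue hd).flipCount ψ ∧
      Γ.nodalCount φ = (P.glue hd).nodalCount ψ + if LeafProfileVanishes r l d then 1 else 0 := by
  let R := (P.reparam (hd.1.trans hd.2)).symm
  let R' := P.gluedReparam hd
  have hg' := R'.isGeneric_comp hg
  have he' := R'.isEigenfunction_comp he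
  refine ⟨P.site.pullback hd (ψ ∘ R'.homeo) ∘ R.homeo,
    R.isEigenfunction_comp (P.site.pullback_isEigenfunction hd hg' he'),
    R.isGeneric_comp (P.site.pullback_isGeneric hd hg' he'), ?_, ?_⟩
  · rw [R.flipCount_comp, P.site.flipCount_pullback hd hg', R'.flipCount_comp]
  · rw [R.nodalCount_comp, P.site.nodalCount_pullback hd hg' he', R'.nodalCount_comp]

end LeafPair

/-! ### Numbering the eigenvalues -/

variable {V' E' : Type*} {Γ' : MetricGraph V' E'} [Fintype E] [Fintype E'] {n : ℕ} {r r' : ℝ}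

theorem IsNthEigenvalue.congr (h : Γ.spec = Γ'.spec) (hr : Γ.IsNthEigenvalue n r) :
    Γ'.IsNthEigenvalue n r := by
  rw [IsNthEigenvalue, ← h]
  exact hr

theorem IsNthEigenvalue.le (h : Γ.IsNthEigenvalue n r) (h' : Γ.IsNthEigenvalue n r') :
    r ≤ r' := by
  by_contra! hlt
  have hsub : {p : ℝ × ℕ | p.1 ≤ r' ∧ p.2 < Γ.spec p.1} ⊆
      {p : ℝ × ℕ | p.1 < r ∧ p.2 < Γ.spec p.1} := fun p hp => ⟨hp.1.trans_lt hlt, hp.2⟩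
  exact lt_irrefl _ ((h'.2.trans (Set.encard_le_encard hsub)).trans_lt h.1)

theorem IsNthEigenvalue.unique (h : Γ.IsNthEigenvalue n r) (h' : Γ.IsNthEigenvalue n r') :
    r = r' := le_antisymm (h.le h') (h'.le h)

theorem exists_isNthEigenvalue (hfin : {p : ℝ × ℕ | p.1 < r ∧ p.2 < Γ.spec p.1}.Finite)
    (hr : 0 < Γ.spec r) : ∃ n, Γ.IsNthEigenvalue n r := by
  refine ⟨hfin.toFinset.card + 1, ?_, ?_⟩
  · rw [hfin.encard_eq_coe_toFinset_card]
    exact_mod_cast Nat.lt_succ_self _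
  · have hsub : insert (r, 0) {p : ℝ × ℕ | p.1 < r ∧ p.2 < Γ.spec p.1} ⊆
        {p : ℝ × ℕ | p.1 ≤ r ∧ p.2 < Γ.spec p.1} := by
      rintro p (rfl | hp)
      · exact ⟨le_rfl, hr⟩
      · exact ⟨hp.1.le, hp.2⟩
    refine le_trans ?_ (Set.encard_le_encard hsub)
    rw [Set.encard_insert_of_notMem fun h => lt_irrefl _ h.1, hfin.encard_eq_coe_toFinset_card]
    exact_mod_cast le_rfl

/-- If finitely many eigenvalues of the glued graph lie below `r`, then so do finitely many of the
original graph, because gluing removes only Dirichlet–Neumann modes from the spectrum. -/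
theorem LeafPair.finite_spec_lt (P : Γ.LeafPair l) (hd : d ∈ Set.Ioo 0 l)
    (h : {p : ℝ × ℕ | p.1 < r ∧ p.2 < (P.glue hd).spec p.1}.Finite) :
    {p : ℝ × ℕ | p.1 < r ∧ p.2 < Γ.spec p.1}.Finite := by
  obtain ⟨s, hs⟩ := P.exists_spec_eq hd
  refine (h.union ((finite_hasDirichletNeumannMode (hd.1.trans hd.2) r).image
    fun q => (q, s q))).subset ?_
  rintro ⟨q, k⟩ ⟨hq, hk⟩
  by_cases hk' : k < s q
  · left
    refine ⟨hq, ?_⟩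
    rw [(hs q).2]
    exact hk'.trans_le (Nat.le_add_right _ _)
  · right
    have hk2 : k < s q + _ := (hs q).1 ▸ hk
    refine ⟨q, ⟨hq, ?_⟩, ?_⟩
    · by_contra hno
      rw [finrank_lineIf_of_not hno] at hk2
      exact hk' hk2
    · have := finrank_lineIf_le (HasDirichletNeumannMode q l)
      exact Prod.ext rfl (by change s q = k; omega)

/-- Generic eigenfunctions of two glued graphs with the same number come from generic
eigenfunctions of the original graphs with the same number. -/
theorem exists_generic_pair (P : Γ.LeafPair l) (P' : Γ'.LeafPair l) (hd : d ∈ Set.Ioo 0 l)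
    (hspec : Γ.spec = Γ'.spec) (hspec' : (P.glue hd).spec = (P'.glue hd).spec)
    {ψ : (P.glue hd).Space → ℝ} {φ : (P'.glue hd).Space → ℝ}
    (hψ : (P.glue hd).IsNthEigenfunction n ψ) (hφ : (P'.glue hd).IsNthEigenfunction n φ)
    (gψ : (P.glue hd).IsGeneric ψ) (gφ : (P'.glue hd).IsGeneric φ) :
    ∃ (m : ℕ) (ψ' : Γ.Space → ℝ) (φ' : Γ'.Space → ℝ) (c : ℕ),
      Γ.IsNthEigenfunction m ψ' ∧ Γ'.IsNthEigenfunction m φ' ∧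
      Γ.IsGeneric ψ' ∧ Γ'.IsGeneric φ' ∧
      Γ.flipCount ψ' = (P.glue hd).flipCount ψ ∧ Γ'.flipCount φ' = (P'.glue hd).flipCount φ ∧
      Γ.nodalCount ψ' = (P.glue hd).nodalCount ψ + c ∧
      Γ'.nodalCount φ' = (P'.glue hd).nodalCount φ + c := by
  classical
  obtain ⟨r, hn, he⟩ := hψ
  obtain ⟨r', hn', he'⟩ := hφ
  obtain rfl : r = r' := (hn.congr hspec').unique hn'
  obtain ⟨ψ', e1, g1, f1, n1⟩ := P.exists_generic hd gψ he
  obtain ⟨φ', e2, g2, f2, n2⟩ := P'.exists_generic hd gφ he'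
  have hfin := P.finite_spec_lt hd (Set.encard_lt_top_iff.1 (hn.1.trans (ENat.natCast_lt_top n)))
  obtain ⟨m, hm⟩ := exists_isNthEigenvalue hfin (by rw [g1.spec_eq_one e1]; exact one_pos)
  refine ⟨m, ψ', φ', if LeafProfileVanishes r l d then 1 else 0, ⟨r, hm, e1⟩,
    ⟨r, hm.congr hspec, e2⟩, g1, g2, f1, f2, ?_, ?_⟩
  · rw [n1]
    split_ifs <;> rfl
  · rw [n2]
    split_ifs <;> rfl

end MetricGraph

theorem mainTheorem2
    {V₁ E₁ V₂ E₂ : Type*} [Finite V₁] [Fintype E₁] [Finite V₂] [Fintype E₂]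
    (Γ₁ : MetricGraph V₁ E₁) (Γ₂ : MetricGraph V₂ E₂)
    (hconn₁ : ConnectedSpace Γ₁.Space) (hconn₂ : ConnectedSpace Γ₂.Space)
    (l d : ℝ) (hd : d ∈ Set.Ioo 0 l)
    (P₁ : Γ₁.LeafPair l) (P₂ : Γ₂.LeafPair l)
    (hspec : Γ₁.spec = Γ₂.spec)
    (hflip : ∀ (n : ℕ) (ψ : Γ₁.Space → ℝ) (φ : Γ₂.Space → ℝ),
      Γ₁.IsNthEigenfunction n ψ → Γ₂.IsNthEigenfunction n φ →
      Γ₁.IsGeneric ψ → Γ₂.IsGeneric φ → Γ₁.flipCount ψ = Γ₂.flipCount φ)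
    (hnodal : ∀ (n : ℕ) (ψ : Γ₁.Space → ℝ) (φ : Γ₂.Space → ℝ),
      Γ₁.IsNthEigenfunction n ψ → Γ₂.IsNthEigenfunction n φ →
      Γ₁.IsGeneric ψ → Γ₂.IsGeneric φ → Γ₁.nodalCount ψ = Γ₂.nodalCount φ) :
    (P₁.glue hd).spec = (P₂.glue hd).spec ∧
    (∀ (n : ℕ) (ψ : (P₁.glue hd).Space → ℝ) (φ : (P₂.glue hd).Space → ℝ),
      (P₁.glue hd).IsNthEigenfunction n ψ → (P₂.glue hd).IsNthEigenfunction n φ →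
      (P₁.glue hd).IsGeneric ψ → (P₂.glue hd).IsGeneric φ →
      (P₁.glue hd).flipCount ψ = (P₂.glue hd).flipCount φ) ∧
    (∀ (n : ℕ) (ψ : (P₁.glue hd).Space → ℝ) (φ : (P₂.glue hd).Space → ℝ),
      (P₁.glue hd).IsNthEigenfunction n ψ → (P₂.glue hd).IsNthEigenfunction n φ →
      (P₁.glue hd).IsGeneric ψ → (P₂.glue hd).IsGeneric φ →
      (P₁.glue hd).nodalCount ψ = (P₂.glue hd).nodalCount φ) := by
  have hs : (P₁.glue hd).spec = (P₂.glue hd).spec := by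
    obtain ⟨s₁, h₁⟩ := P₁.exists_spec_eq hd
    obtain ⟨s₂, h₂⟩ := P₂.exists_spec_eq hd
    funext r
    have h := congrFun hspec r
    rw [(h₁ r).1, (h₂ r).1] at h
    rw [(h₁ r).2, (h₂ r).2, Nat.add_right_cancel h]
  refine ⟨hs, fun n ψ φ hψ hφ gψ gφ => ?_, fun n ψ φ hψ hφ gψ gφ => ?_⟩ <;>
    obtain ⟨m, ψ', φ', c, nψ, nφ, gψ', gφ', f₁, f₂, n₁, n₂⟩ :=
      MetricGraph.exists_generic_pair P₁ P₂ hd hspec hs hψ hφ gψ gφ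
  · rw [← f₁, ← f₂]
    exact hflip m ψ' φ' nψ nφ gψ' gφ'
  · have h := hnodal m ψ' φ' nψ nφ gψ' gφ'
    rw [n₁, n₂] at h
    exact (ENat.add_left_injective_of_ne_top (ENat.natCast_ne_top c)) h
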